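/- Let $C\subset\mathbb{R}^2$ be a compact convex set with nonempty interior. For $0<\varepsilon\le\frac12$ and $n\ge 0$ let $H^\varepsilon_n$ be the following random two-player game with perfect information on the complete binary tree of depth $n$. The $2^n$ payoff profiles at the leaves are independent and uniformly distributed on $C$ (the $i$-th coordinate is the payoff of Player $i$). Each internal node at depth $n-k$, $1\le k\le n$, is controlled by Player 1 with probability $\frac12+\varepsilon$ and by Player 2 with probability $\frac12-\varepsilon$ if $k$ is odd, and by Player 2 with probability $\frac12+\varepsilon$ and by Player 1 with probability $\frac12-\varepsilon$ if $k$ is even; the controlling players are drawn independently of one another and of the payoffs. Almost surely $H^\varepsilon_n$ has a unique subgame perfect equilibrium; let $\mathrm{Val}(H^\varepsilon_n)\in\mathbb{R}^2$ be its payoff profile. Then for every $\varepsilon\in(0,\frac12]$ there is a Pareto efficient point $(x^\varepsilon,y^\varepsilon)$ of $C$ (a point of $C$ such that no other point $(x',y')\in C$ has $x'\ge x^\varepsilon$ and $y'\ge y^\varepsilon$) such that, as $n\to\infty$, the law of $\mathrm{Val}(H^\varepsilon_n)$ converges weakly to the Dirac measure at $(x^\varepsilon,y^\varepsilon)$. Moreover,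 if $C$ is symmetric (that is, $(x,y)\in C$ implies $(y,x)\in C$), then $x^\varepsilon-y^\varepsilon\to 0$ as $\varepsilon\to 0^+$. -/

import Mathlib

open Filter MeasureTheory Topology

namespace RandomGame

/-- The two players. -/
inductive Player
  | one
  | two

instance : MeasurableSpace Player := ⊤

/-- The payoff of a player at a payoff profile `u = (u.1, u.2)`. -/
def Player.payoff : Player → ℝ × ℝ → ℝ
  | .one, u => u.1
  | .two, u => u.2

/-- A two-player perfect-information game on the complete binary tree of depth `n`. For `n = 0` it
is one leaf, with its payoff profile; for `n + 1` it is the player who controls the root, together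
with the left and the right subgame. -/
def Game : ℕ → Type
  | 0 => ℝ × ℝ
  | n + 1 => Player × Game n × Game n

/-- The product `σ`-algebra on the space of games of depth `n`. -/
instance Game.instMeasurableSpace : (n : ℕ) → MeasurableSpace (Game n)
  | 0 => inferInstanceAs (MeasurableSpace (ℝ × ℝ))
  | n + 1 =>
    letI := Game.instMeasurableSpace n
    inferInstanceAs (MeasurableSpace (Player × Game n × Game n))

/-- A (pure) strategy profile on the complete binary tree of depth `n`: an action at every internal
node, where `false` is left and `true` is right. For `n + 1` it is the action at the root, together
with the profiles in the left and in the right subtree. (The part of a profile that sits at the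
nodes controlled by player `i` is the strategy of player `i`.) -/
def Profile : ℕ → Type
  | 0 => Unit
  | n + 1 => Bool × Profile n × Profile n

/-- The payoff profile at the leaf that is reached when the players follow a strategy profile. -/
def outcome : {n : ℕ} → Game n → Profile n → ℝ × ℝ
  | 0, u, _ => u
  | _ + 1, (_, l, r), (a, s, t) => if a then outcome r t else outcome l s

/-- `IsDeviation i G σ τ`: the profile `τ` arises from `σ` when only player `i` changes strategy,
i.e. `σ` and `τ` prescribe the same action at every node that player `i` does not control. -/
def IsDeviation (i : Player) : {n : ℕ} → Game n → Profile n → Profile n → Prop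
  | 0, _, _, _ => True
  | _ + 1, (j, l, r), (a, s, t), (a', s', t') =>
    (j ≠ i → a' = a) ∧ IsDeviation i l s s' ∧ IsDeviation i r t t'

/-- Nash equilibrium: no player gains by a unilateral change of strategy. -/
def IsNash {n : ℕ} (G : Game n) (σ : Profile n) : Prop :=
  ∀ (i : Player) (τ : Profile n), IsDeviation i G σ τ →
    i.payoff (outcome G τ) ≤ i.payoff (outcome G σ)

/-- Subgame perfect equilibrium: the profile induces a Nash equilibrium in every subgame. -/
def IsSubgamePerfect : {n : ℕ} → Game n → Profile n → Prop
  | 0, G, σ => IsNash G σ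
  | n + 1, G, σ => IsNash (n := n + 1) G σ ∧
      IsSubgamePerfect G.2.1 σ.2.1 ∧ IsSubgamePerfect G.2.2 σ.2.2

open Classical in
/-- The value of a game: the payoff profile at its unique subgame perfect equilibrium (with the
placeholder `(0, 0)` for a game that has several subgame perfect equilibria). -/
noncomputable def value {n : ℕ} (G : Game n) : ℝ × ℝ :=
  if h : ∃! σ : Profile n, IsSubgamePerfect G σ then outcome G h.choose else (0, 0)

/-- The player who is favoured at the nodes of height `k` (the nodes at depth `n - k` in a tree of
depth `n`): Player 1 for odd `k`, Player 2 for even `k`. -/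
def favoured (k : ℕ) : Player := if Odd k then .one else .two

/-- The opponent of a player. -/
def Player.other : Player → Player
  | .one => .two
  | .two => .one

/-- The law of the controlling player of a node of height `k`: the favoured player with probability
`1/2 + ε`, the other player with probability `1/2 - ε`. -/
noncomputable def controllerLaw (ε : ℝ) (k : ℕ) : Measure Player :=
  ENNReal.ofReal (1 / 2 + ε) • Measure.dirac (favoured k) +
    ENNReal.ofReal (1 / 2 - ε) • Measure.dirac (favoured k).other

/-- The law of the hybrid game of depth `n`: all leaf payoffs are independent and uniform on `C`,
and all nodes are controlled independently (of one another and of the payoffs), a node of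
height `k` according to `controllerLaw ε k`. -/
noncomputable def hybridLaw (C : Set (ℝ × ℝ)) (ε : ℝ) : (n : ℕ) → Measure (Game n)
  | 0 => (ProbabilityTheory.cond volume C : Measure (ℝ × ℝ))
  | n + 1 => (controllerLaw ε (n + 1)).prod ((hybridLaw C ε n).prod (hybridLaw C ε n))

/-- The law of the value of the hybrid game of depth `n`. -/
noncomputable def valueLaw (C : Set (ℝ × ℝ)) (ε : ℝ) (n : ℕ) : Measure (ℝ × ℝ) :=
  (hybridLaw C ε n).map value

/-- A sequence of laws on the plane concentrates around the point `c`: its members are probability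
measures, and they converge weakly to the Dirac measure at `c`. -/
def ConcentratesAround (ν : ℕ → Measure (ℝ × ℝ)) (c : ℝ × ℝ) : Prop :=
  ∃ h : ∀ n, IsProbabilityMeasure (ν n),
    Tendsto (β := ProbabilityMeasure (ℝ × ℝ)) (fun n => ⟨ν n, h n⟩) atTop (𝓝 (diracProba c))

/-- `p` is a Pareto efficient point of `C`: it lies in `C`, and no other point of `C` is at least
as good for both players. (The order of `ℝ × ℝ` is the componentwise one.) -/
def IsParetoEfficient (C : Set (ℝ × ℝ)) (p : ℝ × ℝ) : Prop :=
  p ∈ C ∧ ∀ q ∈ C, p ≤ q → q = p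

end RandomGame

/-!
Backward induction turns the law `ν` of the value at depth `n` into the law at depth `n + 1`: draw
two independent profiles from `ν` and let the controlling player choose the better one. As ties have
probability zero, the new law has density `2 (w₁ F(x) + w₂ G(y))` with respect to `ν`, where `F`, `G`
are the distribution functions of the two payoffs and `w₁`, `w₂` the probabilities that the players
are in control. So the laws are given by densities on `C` that are monotone in both coordinates
(`valueLaw_eq_law`, `density_mono`). Three facts yield the limit.

*The one-dimensional dynamics.* For fixed `x` the number `t = F(x)` satisfies
`t' ≤ t ∓ 2ε t (1 - t)`, with alternating sign (`payoffCDF_law_succ_le`), whatever the set `C` is: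
Player 1 gets at most `x` by an own choice only if both options are that bad, and by a choice of
Player 2 only if at least one is. The recursion has a repelling 2-cycle `1/2 ± threshold ε`, and
below it `t` tends to `0` (`tendsto_payoffCDF_law`). The same holds for `G`.

*Inefficient points lose their mass* (`tendsto_law_shell`,
`exists_mem_nhdsWithin_of_not_isParetoEfficient`). If `e ∈ C` dominates `w`, the homotheties with
centre `e` map `C` into itself and improve both payoffs of all points below `e`. They push mass near
`w` towards regions whose density grows faster, at a rate given by the mass passed over.

*At most one efficient point is undecided* (`eq_of_not_exceeds`). If for an efficient point neither
`F` nor `G` ever falls below its threshold, call it undecided. For two such points, the density in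
the rectangle between them would grow by a factor at least `1 + 4ε · threshold ε > 1` in each step,
although the total mass is `1`.

Hence the Pareto frontier is cut at a point `c` (`exists_isParetoEfficient_cut`) from which the mass
of every other efficient point escapes towards `c`, and compactness of `C` gives weak convergence to
the Dirac measure at `c`. For symmetric `C` the laws with `ε = 0` are symmetric, and each player gets
less than a given `x` below the maximal equal share with probability below `1/2` at some depth
(`exists_payoffCDF_lt_half`). Since the laws depend continuously on `ε` and the thresholds tend to
`1/2`, this places `c` near the diagonal for small `ε` (`tendsto_fst_sub_snd`).
-/

namespace RandomGame

/-! ### Backward induction -/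

/-- The choice of player `i` between the payoff profiles `u` and `v`: the one with the larger
payoff for `i`. Ties go to `u`. -/
noncomputable def Player.choice (i : Player) (u v : ℝ × ℝ) : ℝ × ℝ :=
  if i.payoff u < i.payoff v then v else u

/-- The payoff profile obtained by backward induction; unlike `value` it is defined without
reference to equilibria, and it is measurable. -/
noncomputable def inductionValue : {n : ℕ} → Game n → ℝ × ℝ
  | 0, u => u
  | _ + 1, (i, l, r) => i.choice (inductionValue l) (inductionValue r)

/-- A game without ties: wherever backward induction has a player choose, the two options give
this player different payoffs. -/
def IsGeneric : {n : ℕ} → Game n → Prop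
  | 0, _ => True
  | _ + 1, (i, l, r) => IsGeneric l ∧ IsGeneric r ∧
      i.payoff (inductionValue l) ≠ i.payoff (inductionValue r)

lemma isDeviation_refl (i : Player) : ∀ {n : ℕ} (G : Game n) (σ : Profile n),
    IsDeviation i G σ σ
  | 0, _, _ => trivial
  | _ + 1, (_, l, r), (_, s, t) =>
    ⟨fun _ => rfl, isDeviation_refl i l s, isDeviation_refl i r t⟩

lemma IsSubgamePerfect.isNash : ∀ {n : ℕ} {G : Game n} {σ : Profile n},
    IsSubgamePerfect G σ → IsNash G σ
  | 0, _, _, h => h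
  | _ + 1, _, _, h => h.1

/-- In a game without ties, backward induction yields the only subgame perfect equilibrium. -/
lemma IsGeneric.existsUnique_and_outcome : ∀ {n : ℕ} {G : Game n}, IsGeneric G →
    (∃! σ : Profile n, IsSubgamePerfect G σ) ∧
      ∀ σ : Profile n, IsSubgamePerfect G σ → outcome G σ = inductionValue G
  | 0, G, _ => ⟨⟨(), fun _ _ _ => le_rfl, fun _ _ => rfl⟩, fun _ _ => rfl⟩
  | n + 1, (i, l, r), ⟨hl, hr, hne⟩ => by
    obtain ⟨⟨s, hs, hs'⟩, hso⟩ := hl.existsUnique_and_outcome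
    obtain ⟨⟨t, ht, ht'⟩, hto⟩ := hr.existsUnique_and_outcome
    have hs1 := hso s hs
    have ht1 := hto t ht
    have hnash_s := hs.isNash
    have hnash_t := ht.isNash
    -- In equilibrium the subgames are played by `s` and `t`, so the root action must be optimal.
    have root : ∀ (σ : Profile (n + 1)), IsSubgamePerfect (n := n + 1) (i, l, r) σ →
        σ = (decide (i.payoff (inductionValue l) < i.payoff (inductionValue r)), s, t) := by
      rintro ⟨a, s', t'⟩ ⟨h0, h1, h2⟩
      obtain rfl : s' = s := hs' s' h1
      obtain rfl : t' = t := ht' t' h2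
      have h3 := h0 i (!a, s', t') ⟨fun h => absurd rfl h, isDeviation_refl _ _ _,
        isDeviation_refl _ _ _⟩
      rcases a with _ | _
      · simp only [outcome, Bool.not_false, if_true, hs1, ht1] at h3
        have : ¬ i.payoff (inductionValue l) < i.payoff (inductionValue r) := by
          simpa using h3
        simp only [this, decide_false]
        rfl
      · simp only [outcome, Bool.not_true, if_true, hs1, ht1] at h3
        have : i.payoff (inductionValue l) < i.payoff (inductionValue r) :=
          lt_of_le_of_ne (by simpa using h3) hne
        simp only [this, decide_true]
        rfl
    have houtcome : outcome (n := n + 1) (i, l, r)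
        (decide (i.payoff (inductionValue l) < i.payoff (inductionValue r)), s, t) =
        inductionValue (n := n + 1) (i, l, r) := by
      simp [outcome, inductionValue, Player.choice, hs1, ht1]
    refine ⟨⟨_, ⟨?_, hs, ht⟩, root⟩, fun σ hσ => by rw [root σ hσ, houtcome]⟩
    rintro j ⟨a, s', t'⟩ ⟨h1, h2, h3⟩
    have h4 := hnash_s j s' h2
    have h5 := hnash_t j t' h3
    rw [hs1] at h4
    rw [ht1] at h5
    rw [houtcome]
    by_cases hji : i = j
    · subst hji
      have h6 : i.payoff (inductionValue (n := n + 1) (i, l, r)) =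
          max (i.payoff (inductionValue l)) (i.payoff (inductionValue r)) := by
        simp only [inductionValue, Player.choice]
        split_ifs with h
        · exact (max_eq_right h.le).symm
        · exact (max_eq_left (not_lt.mp h)).symm
      rw [h6]
      rcases a with _ | _
      · simpa [outcome] using Or.inl h4
      · simpa [outcome] using Or.inr h5
    · obtain rfl := h1 hji
      simp only [outcome, inductionValue, Player.choice, decide_eq_true_eq]
      split_ifs
      · exact h5
      · exact h4

lemma IsGeneric.value_eq {n : ℕ} {G : Game n} (hG : IsGeneric G) : value G = inductionValue G := by
  obtain ⟨h, h'⟩ := hG.existsUnique_and_outcome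
  rw [value, dif_pos h]
  exact h' _ h.choose_spec.1

@[fun_prop]
lemma Player.continuous_payoff (i : Player) : Continuous i.payoff := by
  cases i
  · exact continuous_fst
  · exact continuous_snd

@[fun_prop]
lemma Player.measurable_payoff (i : Player) : Measurable i.payoff :=
  i.continuous_payoff.measurable

lemma Player.measurable_choice (i : Player) :
    Measurable fun z : (ℝ × ℝ) × (ℝ × ℝ) => i.choice z.1 z.2 :=
  Measurable.ite (measurableSet_lt (by fun_prop) (by fun_prop)) measurable_snd measurable_fst

instance : Countable Player :=
  Function.Injective.countable (f := fun i => match i with | .one => 0 | .two => 1)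
    (β := ℕ) (by rintro (_ | _) (_ | _) <;> simp)

instance : MeasurableSingletonClass Player := ⟨fun _ => trivial⟩

lemma measurable_inductionValue : ∀ n : ℕ, Measurable (inductionValue (n := n))
  | 0 => measurable_id
  | n + 1 => by
    have ih := measurable_inductionValue n
    refine measurable_from_prod_countable_right (α := Player) (β := Game n × Game n) fun i => ?_
    exact i.measurable_choice.comp (f := fun z : Game n × Game n =>
      (inductionValue z.1, inductionValue z.2)) (by fun_prop)

/-! ### The law of the value -/

/-- The sign that tells whether player `i` is favoured (`1`) or not (`-1`) at the nodes of height
`n + 1`. -/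
def sign (n : ℕ) : Player → ℝ
  | .one => (-1) ^ n
  | .two => (-1) ^ (n + 1)

/-- The probability that player `i` controls a node of height `n + 1`. -/
noncomputable def weight (ε : ℝ) (n : ℕ) (i : Player) : ℝ := 1 / 2 + sign n i * ε

/-- The distribution function of the payoff of player `i` under a law of payoff profiles. -/
noncomputable def payoffCDF (i : Player) (ν : Measure (ℝ × ℝ)) (x : ℝ) : ℝ :=
  ν.real {z | i.payoff z ≤ x}

/-- The density, with respect to the law `ν` of the value at depth `n`, of the law at
depth `n + 1`. -/
noncomputable def stepDensity (ε : ℝ) (n : ℕ) (ν : Measure (ℝ × ℝ)) (z : ℝ × ℝ) : ℝ :=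
  2 * (weight ε n .one * payoffCDF .one ν z.1 + weight ε n .two * payoffCDF .two ν z.2)

/-- The laws that start from the uniform law on `C` and evolve by `stepDensity`; by
`map_inductionValue_hybridLaw` they are the laws of the values of the hybrid games. -/
noncomputable def law (C : Set (ℝ × ℝ)) (ε : ℝ) : ℕ → Measure (ℝ × ℝ)
  | 0 => ProbabilityTheory.cond volume C
  | n + 1 => (law C ε n).withDensity fun z => ENNReal.ofReal (stepDensity ε n (law C ε n) z)

lemma sign_other (n : ℕ) (i : Player) : sign n i.other = -sign n i := by
  cases i <;> simp [sign, Player.other, pow_succ]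

lemma sign_succ (n : ℕ) (i : Player) : sign (n + 1) i = -sign n i := by
  cases i <;> simp [sign, pow_succ]

lemma sign_eq_or (n : ℕ) (i : Player) : sign n i = 1 ∨ sign n i = -1 := by
  cases i
  · exact neg_one_pow_eq_or ℝ n
  · exact neg_one_pow_eq_or ℝ (n + 1)

lemma weight_mem_Icc {ε : ℝ} (h0 : 0 ≤ ε) (h1 : ε ≤ 1 / 2) (n : ℕ) (i : Player) :
    weight ε n i ∈ Set.Icc 0 1 := by
  rw [weight]
  rcases sign_eq_or n i with h | h <;> rw [h] <;> constructor <;> linarith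

lemma weight_other (ε : ℝ) (n : ℕ) (i : Player) : weight ε n i.other = 1 - weight ε n i := by
  rw [weight, weight, sign_other]; ring

lemma weight_succ (ε : ℝ) (n : ℕ) (i : Player) : weight ε (n + 1) i = 1 - weight ε n i := by
  rw [weight, weight, sign_succ]; ring

lemma controllerLaw_succ (ε : ℝ) (n : ℕ) :
    controllerLaw ε (n + 1) = ENNReal.ofReal (weight ε n .one) • Measure.dirac .one +
      ENNReal.ofReal (weight ε n .two) • Measure.dirac .two := by
  rcases Nat.even_or_odd n with h | h
  · have h' : Odd (n + 1) := h.add_one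
    simp [controllerLaw, favoured, h', Player.other, weight, sign, h.neg_one_pow, h'.neg_one_pow,
      sub_eq_add_neg]
  · have h' : Even (n + 1) := h.add_one
    have h'' : ¬ Odd (n + 1) := Nat.not_odd_iff_even.mpr h'
    refine Eq.trans ?_ (add_comm _ _)
    simp [controllerLaw, favoured, h'', Player.other, weight, sign, h.neg_one_pow, h'.neg_one_pow,
      sub_eq_add_neg]

section Step

variable {ν : Measure (ℝ × ℝ)}

lemma payoffCDF_nonneg (i : Player) (x : ℝ) : 0 ≤ payoffCDF i ν x := measureReal_nonneg

lemma payoffCDF_le_one [IsProbabilityMeasure ν] (i : Player) (x : ℝ) : payoffCDF i ν x ≤ 1 :=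
  measureReal_le_one

lemma payoffCDF_mono [IsFiniteMeasure ν] (i : Player) : Monotone (payoffCDF i ν) :=
  fun _ _ h => measureReal_mono fun _ hz => le_trans (Set.mem_ofPred.mp hz) h

@[fun_prop]
lemma measurable_payoffCDF [IsFiniteMeasure ν] (i : Player) : Measurable (payoffCDF i ν) :=
  (payoffCDF_mono i).measurable

@[fun_prop]
lemma measurable_stepDensity [IsFiniteMeasure ν] (ε : ℝ) (n : ℕ) :
    Measurable (stepDensity ε n ν) := by
  have h (i : Player) := measurable_payoffCDF (ν := ν) i
  unfold stepDensity
  exact ((((h .one).comp measurable_fst).const_mul _).add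
    (((h .two).comp measurable_snd).const_mul _)).const_mul _

lemma stepDensity_mono [IsFiniteMeasure ν] {ε : ℝ} (h0 : 0 ≤ ε) (h1 : ε ≤ 1 / 2) (n : ℕ) :
    Monotone (stepDensity ε n ν) := fun z w h => by
  have a (i : Player) := (weight_mem_Icc h0 h1 n i).1
  have b := mul_le_mul_of_nonneg_left (payoffCDF_mono (ν := ν) .one h.1) (a .one)
  have c := mul_le_mul_of_nonneg_left (payoffCDF_mono (ν := ν) .two h.2) (a .two)
  unfold stepDensity
  linarith

lemma stepDensity_nonneg {ε : ℝ} (h0 : 0 ≤ ε) (h1 : ε ≤ 1 / 2) (n : ℕ) (z : ℝ × ℝ) :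
    0 ≤ stepDensity ε n ν z := by
  have a (i : Player) (x : ℝ) :=
    mul_nonneg (weight_mem_Icc h0 h1 n i).1 (payoffCDF_nonneg (ν := ν) i x)
  have b := a .one z.1
  have c := a .two z.2
  unfold stepDensity
  linarith

lemma stepDensity_le_two [IsProbabilityMeasure ν] {ε : ℝ} (h0 : 0 ≤ ε) (h1 : ε ≤ 1 / 2) (n : ℕ)
    (z : ℝ × ℝ) : stepDensity ε n ν z ≤ 2 := by
  have a (i : Player) (x : ℝ) := mul_le_mul_of_nonneg_left (payoffCDF_le_one (ν := ν) i x)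
    (weight_mem_Icc h0 h1 n i).1
  have b := a .one z.1
  have c := a .two z.2
  have d := weight_other ε n .one
  simp only [Player.other] at d
  unfold stepDensity
  linarith

/-- In the absence of ties, the law of the better of two independent options has density twice
the distribution function. -/
lemma map_choice_prod [IsProbabilityMeasure ν] (i : Player)
    (hν : ∀ x, ν {z | i.payoff z = x} = 0) :
    (ν.prod ν).map (fun z => i.choice z.1 z.2) =
      ν.withDensity fun z => ENNReal.ofReal (2 * payoffCDF i ν (i.payoff z)) := by
  ext S hS
  rw [Measure.map_apply i.measurable_choice hS, withDensity_apply _ hS]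
  have hi1 : Measurable fun z : (ℝ × ℝ) × (ℝ × ℝ) => i.payoff z.1 :=
    i.measurable_payoff.comp measurable_fst
  have hi2 : Measurable fun z : (ℝ × ℝ) × (ℝ × ℝ) => i.payoff z.2 :=
    i.measurable_payoff.comp measurable_snd
  have hA : MeasurableSet {z : (ℝ × ℝ) × (ℝ × ℝ) | z.1 ∈ S ∧ i.payoff z.2 ≤ i.payoff z.1} :=
    (measurable_fst hS).inter (measurableSet_le hi2 hi1)
  have hB : MeasurableSet {z : (ℝ × ℝ) × (ℝ × ℝ) | z.2 ∈ S ∧ i.payoff z.1 < i.payoff z.2} :=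
    (measurable_snd hS).inter (measurableSet_lt hi1 hi2)
  have hsplit : (fun z : (ℝ × ℝ) × (ℝ × ℝ) => i.choice z.1 z.2) ⁻¹' S =
      {z | z.1 ∈ S ∧ i.payoff z.2 ≤ i.payoff z.1} ∪
        {z | z.2 ∈ S ∧ i.payoff z.1 < i.payoff z.2} := by
    ext z
    simp only [Set.mem_preimage, Player.choice, Set.mem_union, Set.mem_ofPred_eq]
    split_ifs with h
    · simp [h]
    · simp [h, not_lt.mp h]
  have hdisj : Disjoint {z : (ℝ × ℝ) × (ℝ × ℝ) | z.1 ∈ S ∧ i.payoff z.2 ≤ i.payoff z.1}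
      {z | z.2 ∈ S ∧ i.payoff z.1 < i.payoff z.2} :=
    Set.disjoint_left.mpr fun z h h' => absurd h.2 (not_le.mpr h'.2)
  have hlt (x : ℝ) : ν {z | i.payoff z < x} = ν {z | i.payoff z ≤ x} := by
    refine le_antisymm (measure_mono fun z hz => le_of_lt (Set.mem_ofPred.mp hz)) ?_
    calc ν {z | i.payoff z ≤ x} ≤ ν ({z | i.payoff z < x} ∪ {z | i.payoff z = x}) :=
          measure_mono fun z hz => lt_or_eq_of_le (Set.mem_ofPred.mp hz)
      _ ≤ _ := by simpa [hν x] using measure_union_le (μ := ν) {z | i.payoff z < x}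
                    {z | i.payoff z = x}
  have h1 : ν.prod ν {z | z.1 ∈ S ∧ i.payoff z.2 ≤ i.payoff z.1} =
      ∫⁻ z in S, ENNReal.ofReal (payoffCDF i ν (i.payoff z)) ∂ν := by
    rw [Measure.prod_apply hA, ← lintegral_indicator hS]
    refine lintegral_congr fun u => ?_
    by_cases hu : u ∈ S
    · simp [hu, payoffCDF, Set.preimage]
    · simp [hu]
  have h2 : ν.prod ν {z | z.2 ∈ S ∧ i.payoff z.1 < i.payoff z.2} =
      ∫⁻ z in S, ENNReal.ofReal (payoffCDF i ν (i.payoff z)) ∂ν := by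
    rw [Measure.prod_apply_symm hB, ← lintegral_indicator hS]
    refine lintegral_congr fun u => ?_
    by_cases hu : u ∈ S
    · simp [hu, payoffCDF, Set.preimage, hlt]
    · simp [hu]
  rw [hsplit, measure_union hdisj hB, h1, h2, ← two_mul, ← lintegral_const_mul' _ _ (by simp)]
  refine lintegral_congr fun z => ?_
  rw [ENNReal.ofReal_mul (by norm_num)]
  simp

lemma measure_payoff_eq_of_absolutelyContinuous (hν : ν ≪ volume) (i : Player) (x : ℝ) :
    ν {z | i.payoff z = x} = 0 := by
  refine hν ?_
  cases i
  · rw [show {z : ℝ × ℝ | Player.one.payoff z = x} = {x} ×ˢ Set.univ by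
      ext z; simp [Player.payoff], Measure.volume_eq_prod, Measure.prod_prod]
    simp
  · rw [show {z : ℝ × ℝ | Player.two.payoff z = x} = Set.univ ×ˢ {x} by
      ext z; simp [Player.payoff], Measure.volume_eq_prod, Measure.prod_prod]
    simp

/-- One step of the evolution of the laws, as a mixture of the choices of the two players. -/
lemma withDensity_stepDensity [IsProbabilityMeasure ν] (hν : ν ≪ volume) {ε : ℝ} (h0 : 0 ≤ ε)
    (h1 : ε ≤ 1 / 2) (n : ℕ) :
    ν.withDensity (fun z => ENNReal.ofReal (stepDensity ε n ν z)) =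
      ENNReal.ofReal (weight ε n .one) •
          (ν.prod ν).map (fun z => Player.one.choice z.1 z.2) +
        ENNReal.ofReal (weight ε n .two) •
          (ν.prod ν).map (fun z => Player.two.choice z.1 z.2) := by
  have hm (i : Player) : Measurable fun z : ℝ × ℝ =>
      ENNReal.ofReal (2 * payoffCDF i ν (i.payoff z)) :=
    (((measurable_payoffCDF i).comp i.measurable_payoff).const_mul 2).ennreal_ofReal
  have a (i : Player) := (weight_mem_Icc h0 h1 n i).1
  rw [map_choice_prod _ (measure_payoff_eq_of_absolutelyContinuous hν _),
    map_choice_prod _ (measure_payoff_eq_of_absolutelyContinuous hν _),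
    ← withDensity_smul _ (hm _), ← withDensity_smul _ (hm _),
    ← withDensity_add_left ((hm _).const_smul _)]
  congr 1
  ext z
  simp only [Pi.add_apply, Pi.smul_apply, smul_eq_mul]
  rw [← ENNReal.ofReal_mul (a _), ← ENNReal.ofReal_mul (a _), ← ENNReal.ofReal_add]
  · congr 1
    simp only [stepDensity, Player.payoff]
    ring
  · exact mul_nonneg (a _) (mul_nonneg two_pos.le (payoffCDF_nonneg _ _))
  · exact mul_nonneg (a _) (mul_nonneg two_pos.le (payoffCDF_nonneg _ _))

lemma isProbabilityMeasure_withDensity_stepDensity [IsProbabilityMeasure ν] (hν : ν ≪ volume)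
    {ε : ℝ} (h0 : 0 ≤ ε) (h1 : ε ≤ 1 / 2) (n : ℕ) :
    IsProbabilityMeasure (ν.withDensity fun z => ENNReal.ofReal (stepDensity ε n ν z)) := by
  refine ⟨?_⟩
  have a (i : Player) := (weight_mem_Icc h0 h1 n i).1
  have d := weight_other ε n .one
  simp only [Player.other] at d
  rw [withDensity_stepDensity hν h0 h1]
  simp only [Measure.add_apply, Measure.smul_apply, smul_eq_mul,
    Measure.map_apply (Player.measurable_choice _) MeasurableSet.univ, Set.preimage_univ,
    measure_univ, mul_one]
  rw [← ENNReal.ofReal_add (a _) (a _), d]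
  simp

end Step

section Law

variable {C : Set (ℝ × ℝ)} {ε : ℝ}

/-- The standing properties of the laws: they are probability measures on `C` that do not charge
Lebesgue null sets. -/
lemma law_basic (hC : IsCompact C) (hint : (interior C).Nonempty) (h0 : 0 ≤ ε) (h1 : ε ≤ 1 / 2)
    (n : ℕ) : IsProbabilityMeasure (law C ε n) ∧ law C ε n ≪ volume ∧ law C ε n Cᶜ = 0 := by
  induction n with
  | zero =>
    refine ⟨ProbabilityTheory.cond_isProbabilityMeasure_of_finite ?_ hC.measure_lt_top.ne, ?_, ?_⟩
    · exact (Measure.measure_pos_of_nonempty_interior _ hint).ne'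
    · exact ProbabilityTheory.cond_absolutelyContinuous
    · rw [law, ProbabilityTheory.cond_apply hC.measurableSet]
      simp
  | succ n ih =>
    obtain ⟨ih1, ih2, ih3⟩ := ih
    have h : law C ε (n + 1) ≪ law C ε n := withDensity_absolutelyContinuous _ _
    exact ⟨isProbabilityMeasure_withDensity_stepDensity ih2 h0 h1 n, h.trans ih2, h ih3⟩

/-- The backward induction value of a hybrid game of depth `n` has law `law C ε n`, and almost
every hybrid game is free of ties. -/
lemma map_inductionValue_hybridLaw (hC : IsCompact C) (hint : (interior C).Nonempty) (h0 : 0 ≤ ε)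
    (h1 : ε ≤ 1 / 2) (n : ℕ) :
    (hybridLaw C ε n).map inductionValue = law C ε n ∧
      IsProbabilityMeasure (hybridLaw C ε n) ∧ ∀ᵐ G ∂(hybridLaw C ε n), IsGeneric G := by
  induction n with
  | zero =>
    refine ⟨Measure.map_id, ?_, ae_of_all _ fun _ => trivial⟩
    exact (law_basic hC hint h0 h1 0).1
  | succ n ih =>
    obtain ⟨ih1, ih2, ih3⟩ := ih
    obtain ⟨hp, hac, -⟩ := law_basic hC hint h0 h1 n
    have hiv := measurable_inductionValue n
    have hmk (i : Player) : Measurable (Prod.mk i : Game n × Game n → Player × Game n × Game n) :=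
      measurable_prodMk_left
    have hH : hybridLaw C ε (n + 1) =
        ENNReal.ofReal (weight ε n .one) •
            ((hybridLaw C ε n).prod (hybridLaw C ε n)).map (Prod.mk Player.one) +
          ENNReal.ofReal (weight ε n .two) •
            ((hybridLaw C ε n).prod (hybridLaw C ε n)).map (Prod.mk Player.two) := by
      rw [hybridLaw, controllerLaw_succ, Measure.add_prod, Measure.prod_smul_left,
        Measure.prod_smul_left, Measure.dirac_prod, Measure.dirac_prod]
    have hprod : ((hybridLaw C ε n).prod (hybridLaw C ε n)).map
        (Prod.map inductionValue inductionValue) = (law C ε n).prod (law C ε n) := by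
      rw [← Measure.map_prod_map _ _ hiv hiv, ih1]
    have hmap : (hybridLaw C ε (n + 1)).map inductionValue = law C ε (n + 1) := by
      have hi (i : Player) : (((hybridLaw C ε n).prod (hybridLaw C ε n)).map (Prod.mk i)).map
          (inductionValue (n := n + 1)) =
          ((law C ε n).prod (law C ε n)).map fun z => i.choice z.1 z.2 := by
        rw [← hprod, Measure.map_map i.measurable_choice (hiv.prodMap hiv)]
        exact Measure.map_map (measurable_inductionValue (n + 1)) (hmk i)
      rw [law, withDensity_stepDensity hac h0 h1, ← hi, ← hi, hH]
      have hiv' : Measurable fun G : Player × Game n × Game n => inductionValue (n := n + 1) G :=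
        measurable_inductionValue (n + 1)
      refine (Measure.map_add _ _ hiv').trans ?_
      rw [Measure.map_smul, Measure.map_smul]
      rfl
    refine ⟨hmap, ?_, ?_⟩
    · have := (law_basic hC hint h0 h1 (n + 1)).1
      refine ⟨?_⟩
      have h := measure_univ (μ := law C ε (n + 1))
      rwa [← hmap, Measure.map_apply (measurable_inductionValue _) MeasurableSet.univ] at h
    · have hi (i : Player) : ∀ᵐ G ∂(((hybridLaw C ε n).prod (hybridLaw C ε n)).map
          (Prod.mk i)), IsGeneric (n := n + 1) G := by
        refine ((MeasurableEmbedding.prodMk_left i MeasurableEmbedding.id).ae_map_iff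
          (β := Player × Game n × Game n)).mpr ?_
        have hne : ∀ᵐ z ∂((law C ε n).prod (law C ε n)), i.payoff z.1 ≠ i.payoff z.2 := by
          have hs : MeasurableSet {z : (ℝ × ℝ) × (ℝ × ℝ) | i.payoff z.1 = i.payoff z.2} :=
            measurableSet_eq_fun (by fun_prop) (by fun_prop)
          refine measure_mono_null (t := {z | i.payoff z.1 = i.payoff z.2}) (by
            intro z hz; simpa using hz) ?_
          rw [Measure.measure_prod_null hs]
          refine ae_of_all _ fun u => ?_
          simpa [Set.preimage, eq_comm] using
            measure_payoff_eq_of_absolutelyContinuous hac i (i.payoff u)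
        rw [← hprod] at hne
        filter_upwards [Measure.quasiMeasurePreserving_fst.ae ih3,
          Measure.quasiMeasurePreserving_snd.ae ih3,
          ae_of_ae_map (hiv.prodMap hiv).aemeasurable hne] with G ha hb hc
        exact ⟨ha, hb, hc⟩
      rw [hH]
      exact (ae_add_measure_iff (α := Player × Game n × Game n)).mpr
        ⟨Measure.ae_smul_measure (hi _) _, Measure.ae_smul_measure (hi _) _⟩

lemma valueLaw_eq_law (hC : IsCompact C) (hint : (interior C).Nonempty) (h0 : 0 ≤ ε)
    (h1 : ε ≤ 1 / 2) (n : ℕ) : valueLaw C ε n = law C ε n := by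
  obtain ⟨h, -, h'⟩ := map_inductionValue_hybridLaw hC hint h0 h1 n
  rw [← h]
  exact Measure.map_congr (h'.mono fun G hG => hG.value_eq)

end Law

/-! ### The evolution of the payoff distribution functions -/

/-- The distribution function of each payoff is bounded by the same recursion as in a zero-sum
game: when player `i` chooses, the payoff is at most `x` only if both options are, and when the
opponent chooses, only if at least one option is. -/
lemma payoffCDF_law_succ_le {C : Set (ℝ × ℝ)} {ε : ℝ} (hC : IsCompact C)
    (hint : (interior C).Nonempty) (h0 : 0 ≤ ε) (h1 : ε ≤ 1 / 2) (n : ℕ) (i : Player) (x : ℝ) :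
    payoffCDF i (law C ε (n + 1)) x ≤ payoffCDF i (law C ε n) x -
      2 * ε * sign n i * (payoffCDF i (law C ε n) x * (1 - payoffCDF i (law C ε n) x)) := by
  obtain ⟨hp, hac, -⟩ := law_basic hC hint h0 h1 n
  set ν := law C ε n
  set t := payoffCDF i ν x with ht
  have hS : MeasurableSet {z : ℝ × ℝ | i.payoff z ≤ x} :=
    measurableSet_le (by fun_prop) (by fun_prop)
  have key : ((ν.prod ν).map fun z => i.choice z.1 z.2).real {z | i.payoff z ≤ x} ≤ t ^ 2 := by
    rw [map_measureReal_apply i.measurable_choice hS]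
    calc _ ≤ (ν.prod ν).real ({z : ℝ × ℝ | i.payoff z ≤ x} ×ˢ {z : ℝ × ℝ | i.payoff z ≤ x}) := by
          refine measureReal_mono ?_
          rintro ⟨u, v⟩ huv
          simp only [Set.mem_preimage, Player.choice, Set.mem_ofPred_eq, Set.mem_prod] at huv ⊢
          split_ifs at huv with h
          · exact ⟨h.le.trans huv, huv⟩
          · exact ⟨huv, (not_lt.mp h).trans huv⟩
      _ = t ^ 2 := by rw [measureReal_prod_prod, sq]; rfl
  have key' (j : Player) : ((ν.prod ν).map fun z => j.choice z.1 z.2).real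
      {z | i.payoff z ≤ x} ≤ 1 - (1 - t) ^ 2 := by
    rw [map_measureReal_apply j.measurable_choice hS]
    calc _ ≤ (ν.prod ν).real
          ({z : ℝ × ℝ | i.payoff z ≤ x}ᶜ ×ˢ {z : ℝ × ℝ | i.payoff z ≤ x}ᶜ)ᶜ := by
          refine measureReal_mono ?_
          rintro ⟨u, v⟩ huv ⟨hu, hv⟩
          simp only [Set.mem_preimage, Player.choice, Set.mem_compl_iff, Set.mem_ofPred_eq]
            at huv hu hv
          split_ifs at huv
          · exact hv huv
          · exact hu huv
      _ = 1 - (1 - t) ^ 2 := by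
          rw [probReal_compl_eq_one_sub (hS.compl.prod hS.compl), measureReal_prod_prod,
            probReal_compl_eq_one_sub hS, sq]
          rfl
  have a (j : Player) := weight_mem_Icc h0 h1 n j
  have hf (j : Player) : IsProbabilityMeasure ((ν.prod ν).map fun z => j.choice z.1 z.2) :=
    Measure.isProbabilityMeasure_map j.measurable_choice.aemeasurable
  have hfin (j : Player) : (ENNReal.ofReal (weight ε n j) •
      (ν.prod ν).map fun z => j.choice z.1 z.2) {z | i.payoff z ≤ x} ≠ ⊤ :=
    ENNReal.mul_ne_top ENNReal.ofReal_ne_top (measure_ne_top _ _)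
  have hsum : payoffCDF i (law C ε (n + 1)) x =
      weight ε n .one *
          ((ν.prod ν).map fun z => Player.one.choice z.1 z.2).real {z | i.payoff z ≤ x} +
        weight ε n .two *
          ((ν.prod ν).map fun z => Player.two.choice z.1 z.2).real {z | i.payoff z ≤ x} := by
    rw [payoffCDF, law, withDensity_stepDensity hac h0 h1,
      measureReal_add_apply (hfin _) (hfin _), measureReal_ennreal_smul_apply,
      measureReal_ennreal_smul_apply, ENNReal.toReal_ofReal (a _).1, ENNReal.toReal_ofReal (a _).1]
  rw [hsum]
  cases i
  · have k1 := mul_le_mul_of_nonneg_left key (a .one).1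
    have k2 := mul_le_mul_of_nonneg_left (key' .two) (a .two).1
    simp only [weight, sign, pow_succ] at k1 k2 ⊢
    linarith
  · have k1 := mul_le_mul_of_nonneg_left (key' .one) (a .one).1
    have k2 := mul_le_mul_of_nonneg_left key (a .two).1
    simp only [weight, sign, pow_succ] at k1 k2 ⊢
    linarith

/-- The distance from `1 / 2` of the threshold of the one-dimensional dynamics: `1 / 2 + threshold ε`
and `1 / 2 - threshold ε` form the 2-cycle of `t ↦ t ∓ 2 ε t (1 - t)` (with alternating sign) that
separates the attractors `0` and `1`. -/
noncomputable def threshold (ε : ℝ) : ℝ := ε / (2 * (1 + √(1 + ε ^ 2)))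

lemma threshold_eq (ε : ℝ) : threshold ε = ε * (1 / 4 - threshold ε ^ 2) := by
  have h : √(1 + ε ^ 2) ^ 2 = 1 + ε ^ 2 := Real.sq_sqrt (by positivity)
  have h' : 0 < 1 + √(1 + ε ^ 2) := by positivity
  unfold threshold
  field_simp
  linear_combination -4 * ε * h

lemma threshold_pos {ε : ℝ} (h0 : 0 < ε) : 0 < threshold ε := by
  unfold threshold; positivity

lemma threshold_le {ε : ℝ} (h0 : 0 ≤ ε) : threshold ε ≤ ε / 4 := by
  have := threshold_eq ε
  nlinarith [mul_nonneg h0 (sq_nonneg (threshold ε))]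

/-- One step of the zero-sum recursion is monotone, and it maps one threshold to the other. -/
lemma step_le_of_le {ε σ s t : ℝ} (h0 : 0 ≤ ε) (h1 : ε ≤ 1 / 2) (hσ : σ = 1 ∨ σ = -1)
    (hs : 0 ≤ s) (ht : t ≤ 1) (hst : s ≤ t) :
    s - 2 * ε * σ * (s * (1 - s)) ≤ t - 2 * ε * σ * (t * (1 - t)) := by
  have hfac : 0 ≤ 1 - 2 * ε * σ * (1 - s - t) := by
    rcases hσ with rfl | rfl <;> nlinarith
  nlinarith [mul_nonneg (sub_nonneg.mpr hst) hfac]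

/-- Below the threshold, two steps of the zero-sum recursion contract towards `0`. -/
lemma two_step_le {ε σ t u v : ℝ} (h0 : 0 ≤ ε) (h1 : ε ≤ 1 / 2) (hσ : σ = 1 ∨ σ = -1)
    (ht : 0 ≤ t) (hu : 0 ≤ u) (hlt : t ≤ 1 / 2 + σ * threshold ε)
    (htu : u ≤ t - 2 * ε * σ * (t * (1 - t))) (huv : v ≤ u - 2 * ε * (-σ) * (u * (1 - u))) :
    v ≤ t * (1 - 4 * ε ^ 2 * (1 - t) * (1 / 2 + σ * threshold ε - t)) := by
  have hφ := threshold_eq ε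
  have hφ' := threshold_le h0
  have hσ2 : σ ^ 2 = 1 := by rcases hσ with rfl | rfl <;> norm_num
  have hφ0 : 0 ≤ threshold ε := by unfold threshold; positivity
  have hθ1 : 1 / 2 + σ * threshold ε ≤ 1 := by rcases hσ with rfl | rfl <;> linarith
  have hmono := step_le_of_le h0 h1 hσ ht hθ1 hlt
  set w := t - 2 * ε * σ * (t * (1 - t)) with hw
  have hw1 : w ≤ 1 := by
    have := mul_nonneg ht (by linarith : 0 ≤ 1 - t)
    rcases hσ with rfl | rfl <;> nlinarith
  have hmono' := step_le_of_le h0 h1 (σ := -σ) (by rcases hσ with rfl | rfl <;> simp) hu hw1 htu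
  set φ := threshold ε
  have hw' : w ≤ 1 / 2 - σ * φ := by
    refine hmono.trans (le_of_eq ?_)
    linear_combination 2 * σ * hφ + (2 * ε * σ * φ ^ 2) * hσ2
  have h2 : 0 ≤ 4 * ε ^ 2 * (t * (1 - t)) :=
    mul_nonneg (by positivity) (mul_nonneg ht (by linarith))
  have h3 := mul_le_mul_of_nonneg_left (show 1 / 2 + σ * φ - t ≤ 1 - t - w by linarith) h2
  have h4 : w - 2 * ε * (-σ) * (w * (1 - w)) = t - 4 * ε ^ 2 * (t * (1 - t)) * (1 - t - w) := by
    have : w = t - 2 * ε * σ * (t * (1 - t)) := hw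
    have e : w - t = - (2 * ε * σ * (t * (1 - t))) := by linarith
    have : w - 2 * ε * (-σ) * (w * (1 - w)) - t =
        (w - t) + 2 * ε * σ * (t * (1 - t)) + 2 * ε * σ * ((w - t) * (1 - t - w)) := by ring
    rw [e] at this
    linear_combination this - (4 * ε ^ 2 * (t * (1 - t)) * (1 - t - w)) * hσ2
  linarith

/-- The interval below the threshold lies in the basin of attraction of `0`. -/
lemma tendsto_zero_of_lt_threshold {ε : ℝ} {t σ : ℕ → ℝ} (h0 : 0 < ε) (h1 : ε ≤ 1 / 2)
    (hσ : ∀ n, σ n = 1 ∨ σ n = -1) (hσ' : ∀ n, σ (n + 1) = -σ n) (ht : ∀ n, 0 ≤ t n)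
    (hrec : ∀ n, t (n + 1) ≤ t n - 2 * ε * σ n * (t n * (1 - t n))) {N : ℕ}
    (hN : t N < 1 / 2 + σ N * threshold ε) : Tendsto t atTop (𝓝 0) := by
  have hφ' := threshold_le h0.le
  have hφ0 := threshold_pos h0
  set θ := 1 / 2 + σ N * threshold ε with hθ
  have hθ1 : θ < 1 := by rcases hσ N with h | h <;> rw [hθ, h] <;> linarith
  have hσN (k : ℕ) : σ (N + 2 * k) = σ N := by
    induction k with
    | zero => rfl
    | succ k ih => rw [show N + 2 * (k + 1) = N + 2 * k + 1 + 1 by ring, hσ', hσ', ih, neg_neg]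
  set ρ := 1 - 4 * ε ^ 2 * (1 - t N) * (θ - t N) with hρ
  have hpos : 0 < (1 - t N) * (θ - t N) := mul_pos (by linarith) (by linarith)
  have hle : (1 - t N) * (θ - t N) ≤ 1 := by nlinarith [ht N]
  have hε : 4 * ε ^ 2 ≤ 1 := by nlinarith
  have hρ0 : 0 ≤ ρ := by rw [hρ, mul_assoc]; nlinarith [sq_nonneg ε]
  have hρ1 : ρ < 1 := by rw [hρ, mul_assoc]; nlinarith [sq_pos_of_pos h0]
  have hgeo (k : ℕ) : t (N + 2 * k) ≤ ρ ^ k ∧ t (N + 2 * k) ≤ t N := by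
    induction k with
    | zero => exact ⟨by simpa using (by linarith : t N ≤ 1), le_rfl⟩
    | succ k ih =>
      have a := two_step_le (σ := σ (N + 2 * k)) (v := t (N + 2 * (k + 1))) h0.le h1 (hσ _)
        (ht (N + 2 * k)) (ht (N + 2 * k + 1)) (by rw [hσN]; linarith) (hrec _)
        (by rw [← hσ']; exact hrec _)
      rw [hσN, ← hθ] at a
      have b : t (N + 2 * k) * (1 - 4 * ε ^ 2 * (1 - t (N + 2 * k)) * (θ - t (N + 2 * k))) ≤
          t (N + 2 * k) * ρ := by
        refine mul_le_mul_of_nonneg_left ?_ (ht _)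
        have : (1 - t N) * (θ - t N) ≤ (1 - t (N + 2 * k)) * (θ - t (N + 2 * k)) :=
          mul_le_mul (by linarith) (by linarith) (by linarith) (by linarith)
        rw [hρ, mul_assoc, mul_assoc]
        nlinarith [sq_nonneg ε]
      have c : t (N + 2 * (k + 1)) ≤ t (N + 2 * k) * ρ := a.trans b
      constructor
      · rw [pow_succ]
        exact c.trans (mul_le_mul_of_nonneg_right ih.1 hρ0)
      · exact c.trans ((mul_le_of_le_one_right (ht _) hρ1.le).trans ih.2)
  have hall (m : ℕ) : t (m + N) ≤ 2 * ρ ^ (m / 2) := by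
    have hρk : 0 ≤ ρ ^ (m / 2) := pow_nonneg hρ0 _
    obtain ⟨g1, g2⟩ := hgeo (m / 2)
    rcases Nat.even_or_odd' m with ⟨k, hk | hk⟩
    · have : m + N = N + 2 * (m / 2) := by omega
      rw [this]
      linarith
    · have : m + N = N + 2 * (m / 2) + 1 := by omega
      rw [this]
      refine (hrec _).trans ?_
      have htk := ht (N + 2 * (m / 2))
      have : 0 ≤ t (N + 2 * (m / 2)) * (1 - t (N + 2 * (m / 2))) :=
        mul_nonneg htk (by linarith)
      rcases hσ (N + 2 * (m / 2)) with h | h <;> rw [h] <;> nlinarith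
  rw [← tendsto_add_atTop_iff_nat N]
  refine squeeze_zero (fun m => ht _) hall ?_
  have : Tendsto (fun m : ℕ => ρ ^ (m / 2)) atTop (𝓝 0) :=
    (tendsto_pow_atTop_nhds_zero_of_lt_one hρ0 hρ1).comp
      (Nat.tendsto_div_const_atTop two_ne_zero)
  simpa using this.const_mul 2

/-- Once the probability that player `i` gets at most `x` falls below the threshold, it tends
to `0`. -/
lemma tendsto_payoffCDF_law {C : Set (ℝ × ℝ)} {ε : ℝ} (hC : IsCompact C)
    (hint : (interior C).Nonempty) (h0 : 0 < ε) (h1 : ε ≤ 1 / 2) {i : Player} {x : ℝ} {N : ℕ}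
    (hN : payoffCDF i (law C ε N) x < 1 / 2 + sign N i * threshold ε) :
    Tendsto (fun n => payoffCDF i (law C ε n) x) atTop (𝓝 0) :=
  tendsto_zero_of_lt_threshold (σ := fun n => sign n i) h0 h1 (sign_eq_or · i) (sign_succ · i)
    (fun _ => payoffCDF_nonneg _ _)
    (fun n => payoffCDF_law_succ_le hC hint h0.le h1 n i x) hN

/-! ### Mass of a set under successive laws -/

section Growth

variable {C : Set (ℝ × ℝ)} {ε : ℝ}

lemma law_succ_real_le (hC : IsCompact C) (hint : (interior C).Nonempty) (h0 : 0 ≤ ε)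
    (h1 : ε ≤ 1 / 2) (n : ℕ) {S : Set (ℝ × ℝ)} (hS : MeasurableSet S) :
    (law C ε (n + 1)).real S ≤ 2 * (law C ε n).real S := by
  have hp := (law_basic hC hint h0 h1 n).1
  have : law C ε (n + 1) S ≤ 2 * law C ε n S := by
    rw [law, withDensity_apply _ hS, ← setLIntegral_const]
    refine lintegral_mono fun z => ?_
    simpa using ENNReal.ofReal_le_ofReal (stepDensity_le_two h0 h1 n z)
  have h := ENNReal.toReal_mono (by finiteness) this
  simpa [Measure.real] using h

lemma mul_law_real_le_law_succ (hC : IsCompact C) (hint : (interior C).Nonempty) (h0 : 0 ≤ ε)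
    (h1 : ε ≤ 1 / 2) (n : ℕ) {S : Set (ℝ × ℝ)} (hS : MeasurableSet S) {c : ℝ} (hc : 0 ≤ c)
    (h : ∀ z ∈ S, c ≤ stepDensity ε n (law C ε n) z) :
    c * (law C ε n).real S ≤ (law C ε (n + 1)).real S := by
  have hp' := (law_basic hC hint h0 h1 (n + 1)).1
  have : ENNReal.ofReal c * law C ε n S ≤ law C ε (n + 1) S := by
    rw [law, withDensity_apply _ hS, ← setLIntegral_const]
    exact setLIntegral_mono' hS fun z hz => ENNReal.ofReal_le_ofReal (h z hz)
  have h := ENNReal.toReal_mono (by finiteness) this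
  simpa [Measure.real, hc] using h

end Growth

/-! ### Inefficient points lose their mass -/

/-- The density of `law C ε n` with respect to the uniform law on `C`. -/
noncomputable def density (C : Set (ℝ × ℝ)) (ε : ℝ) : ℕ → ℝ × ℝ → ℝ
  | 0, _ => 1
  | n + 1, z => density C ε n z * stepDensity ε n (law C ε n) z

section Density

variable {C : Set (ℝ × ℝ)} {ε : ℝ}

lemma density_nonneg (h0 : 0 ≤ ε) (h1 : ε ≤ 1 / 2) (n : ℕ) (z : ℝ × ℝ) :
    0 ≤ density C ε n z := by
  induction n with
  | zero => exact zero_le_one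
  | succ n ih => exact mul_nonneg ih (stepDensity_nonneg h0 h1 n z)

lemma measurable_density (hC : IsCompact C) (hint : (interior C).Nonempty) (h0 : 0 ≤ ε)
    (h1 : ε ≤ 1 / 2) (n : ℕ) : Measurable (density C ε n) := by
  induction n with
  | zero => exact measurable_const
  | succ n ih =>
    have hp := (law_basic hC hint h0 h1 n).1
    exact ih.mul (measurable_stepDensity ε n)

lemma density_mono (hC : IsCompact C) (hint : (interior C).Nonempty) (h0 : 0 ≤ ε)
    (h1 : ε ≤ 1 / 2) (n : ℕ) : Monotone (density C ε n) := by
  induction n with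
  | zero => exact monotone_const
  | succ n ih =>
    have hp := (law_basic hC hint h0 h1 n).1
    exact fun z w h => mul_le_mul (ih h) (stepDensity_mono h0 h1 n h)
      (stepDensity_nonneg h0 h1 n z) (density_nonneg h0 h1 n w)

lemma density_le (hC : IsCompact C) (hint : (interior C).Nonempty) (h0 : 0 ≤ ε)
    (h1 : ε ≤ 1 / 2) (n : ℕ) (z : ℝ × ℝ) : density C ε n z ≤ 2 ^ n := by
  induction n with
  | zero => exact le_rfl
  | succ n ih =>
    have hp := (law_basic hC hint h0 h1 n).1
    rw [pow_succ]
    exact mul_le_mul ih (stepDensity_le_two h0 h1 n z) (stepDensity_nonneg h0 h1 n z)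
      (by positivity)

lemma law_eq_withDensity (hC : IsCompact C) (hint : (interior C).Nonempty) (h0 : 0 ≤ ε)
    (h1 : ε ≤ 1 / 2) (n : ℕ) : law C ε n =
      (ProbabilityTheory.cond volume C).withDensity fun z => ENNReal.ofReal (density C ε n z) := by
  induction n with
  | zero => simp [law, density]
  | succ n ih =>
    have hp := (law_basic hC hint h0 h1 n).1
    have hm := (measurable_stepDensity (ν := law C ε n) ε n).ennreal_ofReal
    have hm' := (measurable_density hC hint h0 h1 n).ennreal_ofReal
    rw [law]
    conv_lhs => rw [ih]
    rw [← withDensity_mul _ hm' (by rw [← ih]; exact hm)]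
    congr 1
    ext z
    rw [Pi.mul_apply, density, ENNReal.ofReal_mul (density_nonneg h0 h1 n z), ← ih]

/-- The homothety with centre `e` and ratio `r`. -/
def contract (e : ℝ × ℝ) (r : ℝ) (z : ℝ × ℝ) : ℝ × ℝ := e + r • (z - e)

lemma payoff_contract (i : Player) (e : ℝ × ℝ) (r : ℝ) (z : ℝ × ℝ) :
    i.payoff (contract e r z) = i.payoff e + r * (i.payoff z - i.payoff e) := by
  cases i <;> simp [Player.payoff, contract]

lemma map_contract_volume (e : ℝ × ℝ) {r : ℝ} (hr : 0 < r) :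
    (volume : Measure (ℝ × ℝ)).map (contract e r) = ENNReal.ofReal (r ^ 2)⁻¹ • volume := by
  have h1 : (contract e r) = (fun z => e + z) ∘ (fun z => r • z) ∘ fun z => z - e := rfl
  have h2 := Measure.map_addHaar_smul (volume : Measure (ℝ × ℝ)) hr.ne'
  rw [h1, ← Measure.map_map (by fun_prop) (by fun_prop), ← Measure.map_map (by fun_prop)
    (by fun_prop), (measurePreserving_sub_right volume e).map_eq]
  have h3 : (fun z : ℝ × ℝ => r • z) = (r • ·) := rfl
  rw [h3, h2, Measure.map_smul, (measurePreserving_add_left volume e).map_eq,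
    abs_of_pos (by positivity)]
  simp

/-- Comparison of the mass of `S` with the mass of its image under a contraction of `C` into
itself. -/
lemma law_le_of_density_le (hC : IsCompact C) (hconv : Convex ℝ C)
    (hint : (interior C).Nonempty) (h0 : 0 ≤ ε) (h1 : ε ≤ 1 / 2) (n : ℕ) {e : ℝ × ℝ} (he : e ∈ C)
    {r : ℝ} (hr : 0 < r) (hr1 : r ≤ 1) {S S' : Set (ℝ × ℝ)} (hS : MeasurableSet S)
    (hS' : MeasurableSet S') (hmaps : Set.MapsTo (contract e r) S S') {κ : ℝ} (hκ : 0 ≤ κ)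
    (hle : ∀ z ∈ S, density C ε n z ≤ κ * density C ε n (contract e r z)) :
    (law C ε n).real S ≤ κ * (r ^ 2)⁻¹ * (law C ε n).real S' := by
  have hp := (law_basic hC hint h0 h1 n).1
  have hm := (measurable_density hC hint h0 h1 n).ennreal_ofReal
  have hCm := hC.measurableSet
  have hmc : Measurable (contract e r) := by unfold contract; fun_prop
  have hlaw {A : Set (ℝ × ℝ)} (hA : MeasurableSet A) : law C ε n A = (volume C)⁻¹ *
      ∫⁻ z in A ∩ C, ENNReal.ofReal (density C ε n z) := by
    rw [law_eq_withDensity hC hint h0 h1, withDensity_apply _ hA, ProbabilityTheory.cond,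
      Measure.restrict_smul, lintegral_smul_measure, Measure.restrict_restrict hA, smul_eq_mul]
  have hCmaps : Set.MapsTo (contract e r) (S ∩ C) (S' ∩ C) := by
    refine fun z hz => ⟨hmaps hz.1, ?_⟩
    have : contract e r z = (1 - r) • e + r • z := by
      rw [contract, smul_sub, sub_smul, one_smul]; abel
    rw [this]
    exact hconv he hz.2 (by linarith) hr.le (by ring)
  have key : law C ε n S ≤ ENNReal.ofReal κ * ENNReal.ofReal (r ^ 2)⁻¹ * law C ε n S' := by
    rw [hlaw hS, hlaw hS', mul_left_comm]
    gcongr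
    calc ∫⁻ z in S ∩ C, ENNReal.ofReal (density C ε n z)
        ≤ ∫⁻ z in S ∩ C, ENNReal.ofReal κ * ENNReal.ofReal (density C ε n (contract e r z)) := by
          refine setLIntegral_mono' (hS.inter hCm) fun z hz => ?_
          rw [← ENNReal.ofReal_mul hκ]
          exact ENNReal.ofReal_le_ofReal (hle z hz.1)
      _ = ENNReal.ofReal κ *
            ∫⁻ z in S ∩ C, ENNReal.ofReal (density C ε n (contract e r z)) :=
          lintegral_const_mul _ (hm.comp hmc)
      _ ≤ ENNReal.ofReal κ * ∫⁻ z, (S' ∩ C).indicator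
            (fun z => ENNReal.ofReal (density C ε n z)) (contract e r z) := by
          refine mul_le_mul' le_rfl ?_
          rw [← lintegral_indicator (hS.inter hCm)]
          refine lintegral_mono fun z => Set.indicator_apply_le' (fun hz => ?_) fun _ => zero_le
          rw [Set.indicator_of_mem (hCmaps hz)]
      _ = ENNReal.ofReal κ * (ENNReal.ofReal (r ^ 2)⁻¹ *
            ∫⁻ z in S' ∩ C, ENNReal.ofReal (density C ε n z)) := by
          rw [← lintegral_map (hm.indicator (hS'.inter hCm)) hmc, map_contract_volume e hr,
            lintegral_smul_measure, lintegral_indicator (hS'.inter hCm), smul_eq_mul]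
      _ = _ := by ring
  have h := ENNReal.toReal_mono (by finiteness) key
  have hr2 : 0 ≤ (r ^ 2)⁻¹ := by positivity
  simpa [Measure.real, hκ, ENNReal.toReal_ofReal hr2, ENNReal.toReal_mul] using h

/-- If the payoff of player `i` at `z'` exceeds that at `z` by a margin that has mass `m k` at each
time `k`, then the density at `z'` outgrows the density at `z` accordingly. -/
lemma density_mul_prod_le (hC : IsCompact C) (hint : (interior C).Nonempty) (h0 : 0 ≤ ε)
    (h1 : ε ≤ 1 / 2) {i : Player} {z z' : ℝ × ℝ} (hz : z ≤ z') {m : ℕ → ℝ} (hm : ∀ k, 0 ≤ m k)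
    (hgap : ∀ k, payoffCDF i (law C ε k) (i.payoff z) + m k ≤
      payoffCDF i (law C ε k) (i.payoff z')) (n : ℕ) :
    density C ε n z * ∏ k ∈ Finset.range n, (1 + weight ε k i * m k) ≤ density C ε n z' := by
  induction n with
  | zero => simp [density]
  | succ n ih =>
    have hp := (law_basic hC hint h0 h1 n).1
    have hw (j : Player) := (weight_mem_Icc h0 h1 n j).1
    have hstep : stepDensity ε n (law C ε n) z * (1 + weight ε n i * m n) ≤
        stepDensity ε n (law C ε n) z' := by
      have hsum : stepDensity ε n (law C ε n) z + 2 * (weight ε n i * m n) ≤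
          stepDensity ε n (law C ε n) z' := by
        have g := mul_le_mul_of_nonneg_left (hgap n) (hw i)
        have a := mul_le_mul_of_nonneg_left (payoffCDF_mono (ν := law C ε n) .one hz.1) (hw .one)
        have b := mul_le_mul_of_nonneg_left (payoffCDF_mono (ν := law C ε n) .two hz.2) (hw .two)
        unfold stepDensity
        cases i <;> simp only [Player.payoff] at g <;> linarith
      have := mul_le_mul_of_nonneg_right (stepDensity_le_two (ν := law C ε n) h0 h1 n z)
        (mul_nonneg (hw i) (hm n))
      linarith
    rw [Finset.prod_range_succ, density, density]
    calc _ = (density C ε n z * ∏ k ∈ Finset.range n, (1 + weight ε k i * m k)) *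
          (stepDensity ε n (law C ε n) z * (1 + weight ε n i * m n)) := by ring
      _ ≤ _ := mul_le_mul ih hstep (mul_nonneg (stepDensity_nonneg h0 h1 n z)
          (by have := mul_nonneg (hw i) (hm n); linarith)) (density_nonneg h0 h1 n z')

end Density

/-- A sequence that is damped by the product of its own weighted past tends to `0`. -/
lemma tendsto_zero_of_mul_prod_le {a w : ℕ → ℝ} {K c : ℝ} (ha : ∀ n, 0 ≤ a n)
    (hw : ∀ n, 0 ≤ w n) (hw1 : ∀ n, w n + w (n + 1) = 1) (hc : 0 < c)
    (h2 : ∀ n, a (n + 1) ≤ 2 * a n)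
    (h : ∀ n, a n * ∏ k ∈ Finset.range n, (1 + w k * (c * a k)) ≤ K) :
    Tendsto a atTop (𝓝 0) := by
  have hnn (n : ℕ) : 0 ≤ w n * (c * a n) := mul_nonneg (hw n) (mul_nonneg hc.le (ha n))
  have hprod (n : ℕ) : 1 + ∑ k ∈ Finset.range n, w k * (c * a k) ≤
      ∏ k ∈ Finset.range n, (1 + w k * (c * a k)) := by
    induction n with
    | zero => simp
    | succ n ih =>
      have hs := Finset.sum_nonneg fun k (_ : k ∈ Finset.range n) => hnn k
      rw [Finset.sum_range_succ, Finset.prod_range_succ]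
      nlinarith [hnn n]
  by_cases hsum : Summable fun k => w k * (c * a k)
  · have h3 : Tendsto (fun n => w n * a n) atTop (𝓝 0) := by
      have := hsum.tendsto_atTop_zero.const_mul c⁻¹
      rw [mul_zero] at this
      refine this.congr fun n => ?_
      field_simp
    have h4 : Tendsto (fun n => 2 * (w n * a n) + w (n + 1) * a (n + 1)) atTop (𝓝 0) := by
      simpa using (h3.const_mul 2).add ((tendsto_add_atTop_iff_nat 1).mpr h3)
    rw [← tendsto_add_atTop_iff_nat 1]
    refine squeeze_zero (fun n => ha _) (fun n => ?_) h4
    have := mul_le_mul_of_nonneg_left (h2 n) (hw n)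
    have e : a (n + 1) = w n * a (n + 1) + w (n + 1) * a (n + 1) := by
      rw [← add_mul, hw1, one_mul]
    linarith
  · have h3 := (not_summable_iff_tendsto_nat_atTop_of_nonneg hnn).mp hsum
    have h4 : Tendsto (fun n => ∏ k ∈ Finset.range n, (1 + w k * (c * a k))) atTop atTop :=
      tendsto_atTop_mono (fun n => (le_add_of_nonneg_left zero_le_one).trans (hprod n)) h3
    refine squeeze_zero ha (fun n => ?_) (h4.const_div_atTop K)
    have hpos : 0 < ∏ k ∈ Finset.range n, (1 + w k * (c * a k)) :=
      Finset.prod_pos fun k _ => by linarith [hnn k]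
    rw [le_div_iff₀ hpos]
    exact h n

lemma le_iff_forall_payoff {z w : ℝ × ℝ} : z ≤ w ↔ ∀ i : Player, i.payoff z ≤ i.payoff w :=
  ⟨fun h i => by cases i; exacts [h.1, h.2], fun h => ⟨h .one, h .two⟩⟩

/-- The points below `e` at which the payoff of player `i` falls short of that at `e` by an amount
in `(c / 2, c]`. -/
def shell (i : Player) (e : ℝ × ℝ) (c : ℝ) : Set (ℝ × ℝ) :=
  {z | z ≤ e ∧ c / 2 < i.payoff e - i.payoff z ∧ i.payoff e - i.payoff z ≤ c}

lemma measurableSet_shell (i : Player) (e : ℝ × ℝ) (c : ℝ) : MeasurableSet (shell i e c) := by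
  have h : Measurable fun z => i.payoff e - i.payoff z := by fun_prop
  exact measurableSet_Iic.inter ((measurableSet_lt measurable_const h).inter
    (measurableSet_le h measurable_const))

lemma mapsTo_contract_shell (i : Player) (e : ℝ × ℝ) (c : ℝ) {r : ℝ} (hr : 0 < r) :
    Set.MapsTo (contract e r) (shell i e c) (shell i e (r * c)) := by
  rintro z ⟨h1, h2, h3⟩
  rw [le_iff_forall_payoff] at h1
  refine ⟨le_iff_forall_payoff.mpr fun j => ?_, ?_, ?_⟩
  · rw [payoff_contract]; nlinarith [h1 j]
  · rw [payoff_contract]; nlinarith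
  · rw [payoff_contract]; nlinarith

lemma le_contract {e z : ℝ × ℝ} (hz : z ≤ e) {r : ℝ} (hr1 : r ≤ 1) :
    z ≤ contract e r z := by
  rw [le_iff_forall_payoff] at hz ⊢
  intro j
  rw [payoff_contract]
  nlinarith [hz j]

/-- The mass of a shell below a point `e` of `C` tends to `0`. The contraction of ratio `1 / 2`
towards `e` maps the shell to a second one, and that one to a third. The mass of the second shell
makes the density in the third grow relative to the first; it is at least a quarter of the mass of
the first shell, by monotonicity of the density. So the mass of the first shell is damped by its
own past, weighted by the probabilities that player `i` is in control. -/
lemma tendsto_law_shell {C : Set (ℝ × ℝ)} {ε : ℝ} (hC : IsCompact C) (hconv : Convex ℝ C)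
    (hint : (interior C).Nonempty) (h0 : 0 ≤ ε) (h1 : ε ≤ 1 / 2) {e : ℝ × ℝ} (he : e ∈ C)
    (i : Player) (c : ℝ) :
    Tendsto (fun n => (law C ε n).real (shell i e c)) atTop (𝓝 0) := by
  have hp (n : ℕ) := (law_basic hC hint h0 h1 n).1
  have hw (n : ℕ) := (weight_mem_Icc h0 h1 n i).1
  have hquarter (n : ℕ) : 1 / 4 * (law C ε n).real (shell i e c) ≤
      (law C ε n).real (shell i e (1 / 2 * c)) := by
    have := law_le_of_density_le hC hconv hint h0 h1 n he (r := 1 / 2) (κ := 1) (by norm_num)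
      (by norm_num) (measurableSet_shell i e c) (measurableSet_shell i e (1 / 2 * c))
      (mapsTo_contract_shell i e c (by norm_num)) zero_le_one fun z hz => by
        rw [one_mul]
        exact density_mono hC hint h0 h1 n (le_contract hz.1 (by norm_num))
    norm_num at this
    norm_num
    linarith
  refine tendsto_zero_of_mul_prod_le (w := fun n => weight ε n i) (c := 1 / 4) (K := 16)
    (fun n => measureReal_nonneg) hw (fun n => by rw [weight_succ]; ring) (by norm_num)
    (fun n => law_succ_real_le hC hint h0 h1 n (measurableSet_shell i e c)) fun n => ?_
  set P := ∏ k ∈ Finset.range n,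
    (1 + weight ε k i * (1 / 4 * (law C ε k).real (shell i e c))) with hP
  have hPpos : 0 < P := Finset.prod_pos fun k _ => by
    have := mul_nonneg (hw k) (mul_nonneg (by norm_num : (0 : ℝ) ≤ 1 / 4)
      (measureReal_nonneg (μ := law C ε k) (s := shell i e c)))
    linarith
  have := law_le_of_density_le hC hconv hint h0 h1 n he (r := 1 / 4) (κ := P⁻¹) (by norm_num)
    (by norm_num) (measurableSet_shell i e c) (measurableSet_shell i e (1 / 4 * c))
    (mapsTo_contract_shell i e c (by norm_num)) (inv_nonneg.mpr hPpos.le) fun z hz => by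
      rw [inv_mul_eq_div, le_div_iff₀ hPpos]
      refine density_mul_prod_le hC hint h0 h1 (i := i) (le_contract hz.1 (by norm_num))
        (fun k => mul_nonneg (by norm_num) measureReal_nonneg) (fun k => ?_) n
      refine (add_le_add_right (hquarter k) _).trans ?_
      have hdisj : Disjoint {w : ℝ × ℝ | i.payoff w ≤ i.payoff z} (shell i e (1 / 2 * c)) := by
        refine Set.disjoint_left.mpr fun w hw hw' => ?_
        have h2 := hz.2.1
        have h3 := hw'.2.2
        have h4 : i.payoff w ≤ i.payoff z := hw
        linarith
      rw [payoffCDF, ← measureReal_union hdisj (measurableSet_shell _ _ _)]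
      refine measureReal_mono ?_
      rintro w (hw | hw)
      · have h4 : i.payoff w ≤ i.payoff z := hw
        have h5 := le_iff_forall_payoff.mp (le_contract hz.1 (by norm_num : (1 / 4 : ℝ) ≤ 1)) i
        exact h4.trans h5
      · have h2 := hz.2.2
        have h3 := hw.2.1
        rw [Set.mem_ofPred_eq, payoff_contract]
        linarith
  have hle1 : (law C ε n).real (shell i e (1 / 4 * c)) ≤ 1 := measureReal_le_one
  rw [← le_div_iff₀ hPpos]
  refine this.trans ((mul_le_of_le_one_right (by positivity) hle1).trans (le_of_eq ?_))
  norm_num [div_eq_inv_mul]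

/-- Every point of `C` that is not Pareto efficient has a neighbourhood in `C` whose mass tends
to `0`. -/
lemma exists_mem_nhdsWithin_of_not_isParetoEfficient {C : Set (ℝ × ℝ)} {ε : ℝ} (hC : IsCompact C)
    (hconv : Convex ℝ C) (hint : (interior C).Nonempty) (h0 : 0 ≤ ε) (h1 : ε ≤ 1 / 2)
    {w : ℝ × ℝ} (hw : w ∈ C) (hw' : ¬ IsParetoEfficient C w) :
    ∃ t ∈ 𝓝[C] w, Tendsto (fun n => (law C ε n).real t) atTop (𝓝 0) := by
  obtain ⟨q, hq, hwq, hne⟩ : ∃ q ∈ C, w ≤ q ∧ q ≠ w := by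
    by_contra! h
    exact hw' ⟨hw, h⟩
  obtain ⟨i, hi⟩ : ∃ i : Player, i.payoff w < i.payoff q := by
    by_contra! h
    exact hne (le_antisymm (le_iff_forall_payoff.mpr h) hwq)
  obtain ⟨e, he, hei, heo⟩ : ∃ e ∈ C, i.payoff w < i.payoff e ∧
      ∀ᶠ z in 𝓝[C] w, i.other.payoff z ≤ i.other.payoff e := by
    by_cases hmax : ∃ q' ∈ C, i.other.payoff w < i.other.payoff q'
    · -- A slight move from `q` towards `q'` dominates `w` strictly in both payoffs.
      obtain ⟨q', hq', hlt⟩ := hmax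
      have hcont : Continuous fun s : ℝ => i.payoff (contract q s q') := by
        simp only [payoff_contract]; fun_prop
      have hev : ∀ᶠ s in 𝓝[>] (0 : ℝ), i.payoff w < i.payoff (contract q s q') := by
        refine (hcont.tendsto' 0 (i.payoff q) (by simp [payoff_contract])).mono_left
          nhdsWithin_le_nhds |>.eventually_const_lt hi
      obtain ⟨s, hs, hs0, hs1⟩ := (hev.and (Ioo_mem_nhdsGT zero_lt_one)).exists
      refine ⟨contract q s q', ?_, hs, ?_⟩
      · have : contract q s q' = (1 - s) • q + s • q' := by
          rw [contract, smul_sub, sub_smul, one_smul]; abel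
        rw [this]
        exact hconv hq hq' (by linarith) hs0.le (by ring)
      · have hlt' : i.other.payoff w < i.other.payoff (contract q s q') := by
          have := le_iff_forall_payoff.mp hwq i.other
          rw [payoff_contract]
          nlinarith
        have hc := i.other.continuous_payoff.tendsto w
        exact (hc.mono_left nhdsWithin_le_nhds).eventually_le_const hlt'
    · push Not at hmax
      refine ⟨q, hq, hi, eventually_mem_nhdsWithin.mono fun z hz => ?_⟩
      exact (hmax z hz).trans (le_iff_forall_payoff.mp hwq i.other)
  set d := i.payoff e - i.payoff w with hd
  have hdpos : 0 < d := sub_pos.mpr hei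
  refine ⟨shell i e (3 / 2 * d), ?_, tendsto_law_shell hC hconv hint h0 h1 he i _⟩
  have hc : Tendsto (fun z => i.payoff e - i.payoff z) (𝓝[C] w) (𝓝 d) :=
    (tendsto_const_nhds.sub (i.continuous_payoff.tendsto w)).mono_left nhdsWithin_le_nhds
  filter_upwards [heo, hc.eventually_const_lt (show 3 / 2 * d / 2 < d by linarith),
    hc.eventually_le_const (show d < 3 / 2 * d by linarith)] with z h2 h3 h4
  refine ⟨le_iff_forall_payoff.mpr fun j => ?_, h3, h4⟩
  have h5 : i.payoff z ≤ i.payoff e := by linarith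
  cases i <;> cases j <;> assumption

/-! ### Concentration around a Pareto efficient point -/

section Concentration

variable {C : Set (ℝ × ℝ)} {ε : ℝ}

lemma exists_isParetoEfficient_ge (hC : IsCompact C) {w : ℝ × ℝ} (hw : w ∈ C) :
    ∃ e, IsParetoEfficient C e ∧ w ≤ e := by
  obtain ⟨e, he, hmax⟩ := (hC.inter_right (isClosed_Ici (a := w))).exists_isMaxOn
    ⟨w, hw, Set.mem_Ici.mpr le_rfl⟩ (f := fun z : ℝ × ℝ => z.1 + z.2) (by fun_prop)
  refine ⟨e, ⟨he.1, fun q hq heq => ?_⟩, he.2⟩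
  have h : q.1 + q.2 ≤ e.1 + e.2 := hmax ⟨hq, le_trans he.2 heq⟩
  exact Prod.ext (by linarith [heq.1, heq.2]) (by linarith [heq.1, heq.2])

lemma IsParetoEfficient.eq_of_forall_le {p q : ℝ × ℝ} (hp : IsParetoEfficient C p) (hq : q ∈ C)
    (i : Player) (h : i.payoff p ≤ i.payoff q) (h' : i.other.payoff p ≤ i.other.payoff q) :
    q = p :=
  hp.2 q hq (le_iff_forall_payoff.mpr fun j => by cases i <;> cases j <;> assumption)

/-- Between two Pareto efficient points the interests of the players are opposed. -/
lemma IsParetoEfficient.other_payoff_lt {p q : ℝ × ℝ} (hp : IsParetoEfficient C p)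
    (hq : q ∈ C) {i : Player} (h : i.payoff p < i.payoff q) :
    i.other.payoff q < i.other.payoff p := by
  by_contra! h'
  exact h.ne (by rw [hp.eq_of_forall_le hq i h.le h'])

lemma law_zero_real_pos (hC : IsCompact C) (hconv : Convex ℝ C) (hint : (interior C).Nonempty)
    {U : Set (ℝ × ℝ)} (hU : IsOpen U) (hUC : (C ∩ U).Nonempty) : 0 < (law C ε 0).real U := by
  obtain ⟨z, hz, hzU⟩ := hUC
  have hzc : z ∈ closure (interior C) := by
    rw [hconv.closure_interior_eq_closure_of_nonempty_interior hint]
    exact subset_closure hz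
  have hne : (U ∩ interior C).Nonempty := mem_closure_iff.mp hzc U hU hzU
  have hpos : 0 < volume (C ∩ U) :=
    ((hU.inter isOpen_interior).measure_pos volume hne).trans_le
      (measure_mono fun y hy => ⟨interior_subset hy.2, hy.1⟩)
  have hfin : volume C ≠ ⊤ := hC.measure_lt_top.ne
  rw [Measure.real, law, ProbabilityTheory.cond_apply hC.measurableSet]
  refine ENNReal.toReal_pos (mul_ne_zero (ENNReal.inv_ne_zero.mpr hfin) hpos.ne') ?_
  refine ENNReal.mul_ne_top (ENNReal.inv_ne_top.mpr ?_)
    (ne_top_of_le_ne_top hfin (measure_mono Set.inter_subset_left))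
  exact (hpos.trans_le (measure_mono Set.inter_subset_left)).ne'

/-- If the distribution functions at `a` and `b` stay above the thresholds, then the mass of the
quadrant above `(a, b)` grows geometrically. -/
lemma pow_mul_law_quadrant_le (hC : IsCompact C) (hint : (interior C).Nonempty) (h0 : 0 ≤ ε)
    (h1 : ε ≤ 1 / 2) {a b : ℝ}
    (ha : ∀ n, 1 / 2 + sign n .one * threshold ε ≤ payoffCDF .one (law C ε n) a)
    (hb : ∀ n, 1 / 2 + sign n .two * threshold ε ≤ payoffCDF .two (law C ε n) b) (n : ℕ) :
    (1 + 4 * ε * threshold ε) ^ n * (law C ε 0).real (Set.Ioi a ×ˢ Set.Ioi b) ≤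
      (law C ε n).real (Set.Ioi a ×ˢ Set.Ioi b) := by
  have hφ : 0 ≤ threshold ε := by unfold threshold; positivity
  have hc : 0 ≤ 1 + 4 * ε * threshold ε := by positivity
  induction n with
  | zero => simp
  | succ n ih =>
    have hp := (law_basic hC hint h0 h1 n).1
    rw [pow_succ', mul_assoc]
    refine (mul_le_mul_of_nonneg_left ih hc).trans (mul_law_real_le_law_succ hC hint h0 h1 n
      (measurableSet_Ioi.prod measurableSet_Ioi) hc fun z hz => ?_)
    have hw (j : Player) := (weight_mem_Icc h0 h1 n j).1
    have g1 := mul_le_mul_of_nonneg_left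
      ((ha n).trans (payoffCDF_mono .one (le_of_lt hz.1))) (hw .one)
    have g2 := mul_le_mul_of_nonneg_left
      ((hb n).trans (payoffCDF_mono .two (le_of_lt hz.2))) (hw .two)
    have hs : sign n .two = - sign n .one := sign_other n .one
    unfold stepDensity
    simp only [weight, hs] at g1 g2 ⊢
    rcases sign_eq_or n .one with h | h <;> rw [h] at g1 g2 ⊢ <;> linarith

/-- The probability that player `i` gets more than `x` tends to `1` as the depth grows. -/
def Exceeds (C : Set (ℝ × ℝ)) (ε : ℝ) (i : Player) (x : ℝ) : Prop :=
  Tendsto (fun n => payoffCDF i (law C ε n) x) atTop (𝓝 0)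

lemma Exceeds.mono (hC : IsCompact C) (hint : (interior C).Nonempty) (h0 : 0 ≤ ε)
    (h1 : ε ≤ 1 / 2) {i : Player} {x y : ℝ} (h : Exceeds C ε i y) (hxy : x ≤ y) :
    Exceeds C ε i x :=
  squeeze_zero (fun _ => payoffCDF_nonneg _ _) (fun n => by
    have := (law_basic hC hint h0 h1 n).1
    exact payoffCDF_mono i hxy) h

/-- No payoff profile exceeds a Pareto efficient one in both coordinates. -/
lemma IsParetoEfficient.not_exceeds (hC : IsCompact C) (hint : (interior C).Nonempty)
    (h0 : 0 ≤ ε) (h1 : ε ≤ 1 / 2) {e : ℝ × ℝ} (he : IsParetoEfficient C e) {i : Player}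
    (h : Exceeds C ε i (i.payoff e)) : ¬ Exceeds C ε i.other (i.other.payoff e) := by
  intro h'
  have hsum := h.add h'
  rw [add_zero] at hsum
  refine absurd (ge_of_tendsto' hsum (b := 1) fun n => ?_) (by norm_num)
  obtain ⟨hp, -, hnull⟩ := law_basic hC hint h0 h1 n
  have hcover : (Set.univ : Set (ℝ × ℝ)) ⊆
      ({z | i.payoff z ≤ i.payoff e} ∪ {z | i.other.payoff z ≤ i.other.payoff e}) ∪ Cᶜ := by
    intro z _
    by_contra! hz
    simp only [Set.mem_union, Set.mem_ofPred_eq, Set.mem_compl_iff, not_or, not_le, not_not] at hz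
    obtain ⟨⟨z1, z2⟩, z3⟩ := hz
    exact z1.ne (by rw [he.eq_of_forall_le z3 i z1.le z2.le])
  have hnull' : (law C ε n).real Cᶜ = 0 := by simp [Measure.real, hnull]
  calc (1 : ℝ) = (law C ε n).real Set.univ := probReal_univ.symm
    _ ≤ _ := measureReal_mono hcover
    _ ≤ _ := measureReal_union_le _ _
    _ ≤ _ := by rw [hnull', add_zero]; exact measureReal_union_le _ _

/-- At most one Pareto efficient point is exceeded by neither player: between two such points the
density would grow geometrically. -/
lemma eq_of_not_exceeds (hC : IsCompact C) (hconv : Convex ℝ C) (hint : (interior C).Nonempty)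
    (h0 : 0 < ε) (h1 : ε ≤ 1 / 2) {p q : ℝ × ℝ} (hp : IsParetoEfficient C p)
    (hq : IsParetoEfficient C q) (hp' : ∀ i : Player, ¬ Exceeds C ε i (i.payoff p))
    (hq' : ∀ i : Player, ¬ Exceeds C ε i (i.payoff q)) : p = q := by
  wlog hpq : p.1 ≤ q.1 generalizing p q
  · exact (this hq hp hq' hp' (le_of_not_ge hpq)).symm
  rcases hpq.eq_or_lt with heq | hlt
  · rcases le_total p.2 q.2 with h | h
    · exact (hp.2 q hq.1 ⟨hpq, h⟩).symm
    · exact hq.2 p hp.1 ⟨heq.ge, h⟩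
  exfalso
  have hlt' : q.2 < p.2 := hp.other_payoff_lt hq.1 (i := .one) hlt
  have hbig {i : Player} {x : ℝ} (h : ¬ Exceeds C ε i x) (n : ℕ) :
      1 / 2 + sign n i * threshold ε ≤ payoffCDF i (law C ε n) x := by
    by_contra! h'
    exact h (tendsto_payoffCDF_law hC hint h0 h1 h')
  have hgrow := pow_mul_law_quadrant_le hC hint h0.le h1 (hbig (hp' .one)) (hbig (hq' .two))
  have hpos : 0 < (law C ε 0).real (Set.Ioi (Player.one.payoff p) ×ˢ
      Set.Ioi (Player.two.payoff q)) := by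
    refine law_zero_real_pos hC hconv hint (isOpen_Ioi.prod isOpen_Ioi)
      ⟨(1 / 2 : ℝ) • p + (1 / 2 : ℝ) • q,
        hconv hp.1 hq.1 (by norm_num) (by norm_num) (by norm_num), ?_, ?_⟩
    · simp only [Set.mem_Ioi, Player.payoff, Prod.fst_add, Prod.smul_fst, smul_eq_mul]; linarith
    · simp only [Set.mem_Ioi, Player.payoff, Prod.snd_add, Prod.smul_snd, smul_eq_mul]; linarith
  have hφ := threshold_pos h0
  have hlim : Tendsto (fun n : ℕ => (1 + 4 * ε * threshold ε) ^ n * (law C ε 0).real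
      (Set.Ioi (Player.one.payoff p) ×ˢ Set.Ioi (Player.two.payoff q))) atTop atTop :=
    (tendsto_pow_atTop_atTop_of_one_lt (by nlinarith [mul_pos h0 hφ])).atTop_mul_const hpos
  obtain ⟨n, hn⟩ := (hlim.eventually_gt_atTop 1).exists
  have := (law_basic hC hint h0.le h1 n).1
  exact absurd (hn.trans_le (hgrow n)) (not_lt.mpr measureReal_le_one)

/-- The Pareto frontier is cut at a point `c` such that in the long run each player exceeds all
efficient points that are worse for this player than `c`. -/
lemma exists_isParetoEfficient_cut (hC : IsCompact C) (hconv : Convex ℝ C)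
    (hint : (interior C).Nonempty) (h0 : 0 < ε) (h1 : ε ≤ 1 / 2) :
    ∃ c, IsParetoEfficient C c ∧ ∀ e, IsParetoEfficient C e → ∀ i : Player,
      i.payoff e < i.payoff c → Exceeds C ε i (i.payoff e) := by
  by_cases hex : ∃ c, IsParetoEfficient C c ∧ ∀ i : Player, ¬ Exceeds C ε i (i.payoff c)
  · obtain ⟨c, hc, hc'⟩ := hex
    refine ⟨c, hc, fun e he i hlt => ?_⟩
    by_contra hi
    have ho : ¬ Exceeds C ε i.other (i.other.payoff e) := fun h =>
      hc' i.other (h.mono hC hint h0.le h1 (he.other_payoff_lt hc.1 hlt).le)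
    have : e = c := eq_of_not_exceeds hC hconv hint h0 h1 he hc
      (fun j => by cases i <;> cases j <;> assumption) hc'
    exact hlt.ne (by rw [this])
  · push Not at hex
    obtain ⟨z, hz, hz'⟩ : ∃ z ∈ C, ∀ e, IsParetoEfficient C e → ∀ i : Player,
        Exceeds C ε i (i.payoff e) → i.payoff e ≤ i.payoff z := by
      rcases Set.eq_empty_or_nonempty
        {e | IsParetoEfficient C e ∧ Exceeds C ε .one e.1} with hA | hA
      · obtain ⟨z, hz, hmax⟩ := hC.exists_isMaxOn (hint.mono interior_subset)
          (f := Prod.snd) (by fun_prop)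
        refine ⟨z, hz, fun e he i hi => ?_⟩
        cases i
        · exact absurd ⟨he, hi⟩ (Set.eq_empty_iff_forall_notMem.mp hA e)
        · exact hmax he.1
      · have hsub : {e | IsParetoEfficient C e ∧ Exceeds C ε .one e.1} ⊆ C := fun e he => he.1.1
        have hcl : closure {e | IsParetoEfficient C e ∧ Exceeds C ε .one e.1} ⊆ C :=
          closure_minimal hsub hC.isClosed
        obtain ⟨z, hz, hmax⟩ := (hC.of_isClosed_subset isClosed_closure hcl).exists_isMaxOn
          hA.closure (f := Prod.fst) (by fun_prop)
        refine ⟨z, hcl hz, fun e he i hi => ?_⟩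
        cases i
        · exact hmax (subset_closure ⟨he, hi⟩)
        · have hclosed : IsClosed {w : ℝ × ℝ | e.2 ≤ w.2} :=
            isClosed_le continuous_const continuous_snd
          refine closure_minimal (fun w hw => ?_) hclosed hz
          by_contra hlt
          exact hw.1.not_exceeds hC hint h0.le h1 (i := .one) hw.2
            (hi.mono hC hint h0.le h1 (le_of_not_ge hlt))
    obtain ⟨c, hc, hzc⟩ := exists_isParetoEfficient_ge hC hz
    refine ⟨c, hc, fun e he i hlt => ?_⟩
    by_contra hi
    obtain ⟨j, hj⟩ := hex e he
    have hj' : Exceeds C ε i.other (i.other.payoff e) := by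
      cases i <;> cases j <;> first | exact hj | exact absurd hj hi
    have hle := (hz' e he _ hj').trans (le_iff_forall_payoff.mp hzc _)
    exact absurd hle (not_le.mpr (he.other_payoff_lt hc.1 hlt))

/-- A compact subset of `C` each of whose points has a neighbourhood of vanishing mass has itself
vanishing mass. -/
lemma tendsto_law_of_isCompact (hC : IsCompact C) (hint : (interior C).Nonempty) (h0 : 0 ≤ ε)
    (h1 : ε ≤ 1 / 2) {K : Set (ℝ × ℝ)} (hK : IsCompact K)
    (h : ∀ w ∈ K, ∃ t ∈ 𝓝[K] w, Tendsto (fun n => (law C ε n).real t) atTop (𝓝 0)) :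
    Tendsto (fun n => (law C ε n).real K) atTop (𝓝 0) := by
  have hp (n : ℕ) := (law_basic hC hint h0 h1 n).1
  refine hK.induction_on (p := fun s => Tendsto (fun n => (law C ε n).real s) atTop (𝓝 0))
    (by simp) (fun s t hst ht => ?_) (fun s t hs ht => ?_) h
  · exact squeeze_zero (fun _ => measureReal_nonneg) (fun n => measureReal_mono hst) ht
  · refine squeeze_zero (fun _ => measureReal_nonneg) (fun n => measureReal_union_le s t) ?_
    simpa using hs.add ht

/-- The laws concentrate around the cut point. -/
lemma exists_isParetoEfficient_forall_tendsto (hC : IsCompact C) (hconv : Convex ℝ C)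
    (hint : (interior C).Nonempty) (h0 : 0 < ε) (h1 : ε ≤ 1 / 2) :
    ∃ c, IsParetoEfficient C c ∧ ∀ U, IsOpen U → c ∈ U →
      Tendsto (fun n => (law C ε n).real Uᶜ) atTop (𝓝 0) := by
  obtain ⟨c, hc, hcut⟩ := exists_isParetoEfficient_cut hC hconv hint h0 h1
  refine ⟨c, hc, fun U hU hcU => ?_⟩
  have hK : Tendsto (fun n => (law C ε n).real (C \ U)) atTop (𝓝 0) := by
    refine tendsto_law_of_isCompact hC hint h0.le h1 (hC.diff hU) fun w hw => ?_
    suffices h : ∃ t ∈ 𝓝[C] w, Tendsto (fun n => (law C ε n).real t) atTop (𝓝 0) by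
      obtain ⟨t, ht, ht'⟩ := h
      exact ⟨t, nhdsWithin_mono w Set.sdiff_subset ht, ht'⟩
    by_cases hwP : IsParetoEfficient C w
    · obtain ⟨i, hi⟩ : ∃ i : Player, i.payoff w < i.payoff c := by
        by_contra! h
        exact hw.2 (hc.2 w hw.1 (le_iff_forall_payoff.mpr h) ▸ hcU)
      have ho := hwP.other_payoff_lt hc.1 hi
      -- An efficient point above the midpoint of `w` and `c` separates them.
      have hm : (1 / 2 : ℝ) • w + (1 / 2 : ℝ) • c ∈ C :=
        hconv hw.1 hc.1 (by norm_num) (by norm_num) (by norm_num)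
      have hpay (j : Player) : j.payoff ((1 / 2 : ℝ) • w + (1 / 2 : ℝ) • c) =
          (j.payoff w + j.payoff c) / 2 := by
        cases j <;> simp [Player.payoff] <;> ring
      obtain ⟨e, he, hme⟩ := exists_isParetoEfficient_ge hC hm
      have hme' := le_iff_forall_payoff.mp hme
      have hwe : i.payoff w < i.payoff e := by
        have := hme' i
        rw [hpay] at this
        linarith
      have hec : i.payoff e < i.payoff c := by
        by_contra! hle
        have := hme' i.other
        rw [hpay] at this
        have hlt : i.other.payoff c < i.other.payoff e := by linarith
        exact hlt.ne (by rw [hc.eq_of_forall_le he.1 i hle hlt.le])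
      refine ⟨{z | i.payoff z ≤ i.payoff e}, ?_, hcut e he i hec⟩
      exact mem_nhdsWithin_of_mem_nhds
        ((i.continuous_payoff.tendsto w).eventually_le_const hwe)
    · exact exists_mem_nhdsWithin_of_not_isParetoEfficient hC hconv hint h0.le h1 hw.1 hwP
  refine squeeze_zero (fun _ => measureReal_nonneg) (fun n => ?_) hK
  obtain ⟨hp, -, hnull⟩ := law_basic hC hint h0.le h1 n
  have hnull' : (law C ε n).real Cᶜ = 0 := by simp [Measure.real, hnull]
  calc _ ≤ (law C ε n).real ((C \ U) ∪ Cᶜ) := measureReal_mono fun z hz => by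
        by_cases hzC : z ∈ C
        · exact Or.inl ⟨hzC, hz⟩
        · exact Or.inr hzC
    _ ≤ _ := measureReal_union_le _ _
    _ = _ := by rw [hnull', add_zero]

lemma concentratesAround_of_forall_tendsto {ν : ℕ → Measure (ℝ × ℝ)}
    (hν : ∀ n, IsProbabilityMeasure (ν n)) {c : ℝ × ℝ}
    (h : ∀ U, IsOpen U → c ∈ U → Tendsto (fun n => (ν n).real Uᶜ) atTop (𝓝 0)) :
    ConcentratesAround ν c := by
  let P (n : ℕ) : ProbabilityMeasure (ℝ × ℝ) := ⟨ν n, hν n⟩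
  refine ⟨hν, tendsto_of_forall_isOpen_le_liminf (μs := P) fun U hU => ?_⟩
  by_cases hcU : c ∈ U
  · have hlim : Tendsto (fun n => P n U) atTop (𝓝 1) := by
      rw [← NNReal.tendsto_coe]
      have := (h U hU hcU).const_sub 1
      rw [sub_zero] at this
      refine this.congr fun n => ?_
      rw [probReal_compl_eq_one_sub hU.measurableSet, sub_sub_cancel]
      rfl
    rw [hlim.liminf_eq]
    exact ProbabilityMeasure.apply_le_one _ _
  · have : (diracProba c : ProbabilityMeasure (ℝ × ℝ)) U = 0 := by
      rw [← ENNReal.coe_inj, ProbabilityMeasure.ennreal_coeFn_eq_coeFn_toMeasure]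
      simp [diracProba, hcU, hU.measurableSet]
    rw [this]
    exact zero_le

end Concentration

/-! ### Symmetric sets of payoffs -/

section Symmetric

variable {C : Set (ℝ × ℝ)}

lemma payoffCDF_law_eq_integral {ε : ℝ} (hC : IsCompact C) (hint : (interior C).Nonempty)
    (h0 : 0 ≤ ε) (h1 : ε ≤ 1 / 2) (n : ℕ) (i : Player) (x : ℝ) :
    payoffCDF i (law C ε n) x =
      ∫ z in {z | i.payoff z ≤ x}, density C ε n z ∂(ProbabilityTheory.cond volume C) := by
  have hS : MeasurableSet {z : ℝ × ℝ | i.payoff z ≤ x} :=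
    measurableSet_le (by fun_prop) (by fun_prop)
  rw [payoffCDF, law_eq_withDensity hC hint h0 h1, Measure.real, withDensity_apply _ hS,
    integral_eq_lintegral_of_nonneg_ae (ae_of_all _ (density_nonneg h0 h1 n))
      (measurable_density hC hint h0 h1 n).aestronglyMeasurable]

/-- The laws depend continuously on the bias `ε` at `0`. -/
lemma tendsto_payoffCDF_law_bias (hC : IsCompact C) (hint : (interior C).Nonempty) (n : ℕ) :
    (∀ z, Tendsto (fun ε => density C ε n z) (𝓝[>] 0) (𝓝 (density C 0 n z))) ∧
      ∀ i x, Tendsto (fun ε => payoffCDF i (law C ε n) x) (𝓝[>] 0)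
        (𝓝 (payoffCDF i (law C 0 n) x)) := by
  have hp := (law_basic hC hint le_rfl (by norm_num) 0 : IsProbabilityMeasure (law C 0 0) ∧ _).1
  have hsmall : ∀ᶠ ε in 𝓝[>] (0 : ℝ), 0 ≤ ε ∧ ε ≤ 1 / 2 :=
    mem_of_superset (Ioc_mem_nhdsGT (by norm_num : (0 : ℝ) < 1 / 2)) fun ε h => ⟨h.1.le, h.2⟩
  have hdens {n : ℕ} (h : ∀ z, Tendsto (fun ε => density C ε n z) (𝓝[>] 0) (𝓝 (density C 0 n z)))
      (i : Player) (x : ℝ) : Tendsto (fun ε => payoffCDF i (law C ε n) x) (𝓝[>] 0)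
        (𝓝 (payoffCDF i (law C 0 n) x)) := by
    rw [payoffCDF_law_eq_integral hC hint le_rfl (by norm_num)]
    have hlim : Tendsto (fun ε => ∫ z in {z | i.payoff z ≤ x}, density C ε n z
        ∂(ProbabilityTheory.cond volume C)) (𝓝[>] 0) (𝓝 (∫ z in {z | i.payoff z ≤ x},
          density C 0 n z ∂(ProbabilityTheory.cond volume C))) := by
      refine tendsto_integral_filter_of_dominated_convergence (fun _ => 2 ^ n)
        (hsmall.mono fun ε hε => (measurable_density hC hint hε.1 hε.2 n).aestronglyMeasurable)
        (hsmall.mono fun ε hε => ae_of_all _ fun z => ?_) ?_ (ae_of_all _ h)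
      · rw [Real.norm_of_nonneg (density_nonneg hε.1 hε.2 n z)]
        exact density_le hC hint hε.1 hε.2 n z
      · have : IsProbabilityMeasure (ProbabilityTheory.cond volume C) := hp
        exact integrable_const _
    refine hlim.congr' (hsmall.mono fun ε hε => ?_)
    exact (payoffCDF_law_eq_integral hC hint hε.1 hε.2 n i x).symm
  induction n with
  | zero => exact ⟨fun z => tendsto_const_nhds, hdens fun z => tendsto_const_nhds⟩
  | succ n ih =>
    obtain ⟨ih1, ih2⟩ := ih
    have h (z : ℝ × ℝ) : Tendsto (fun ε => density C ε (n + 1) z) (𝓝[>] 0)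
        (𝓝 (density C 0 (n + 1) z)) := by
      have hw (j : Player) : Tendsto (fun ε => weight ε n j) (𝓝[>] 0) (𝓝 (weight 0 n j)) := by
        refine Tendsto.mono_left (Continuous.tendsto ?_ 0) nhdsWithin_le_nhds
        unfold weight
        fun_prop
      exact (ih1 z).mul ((((hw .one).mul (ih2 .one z.1)).add
        ((hw .two).mul (ih2 .two z.2))).const_mul 2)
    exact ⟨h, hdens h⟩

lemma measurePreserving_swap_cond (hC : IsCompact C) (hsymm : ∀ x y : ℝ, (x, y) ∈ C → (y, x) ∈ C) :
    MeasurePreserving Prod.swap (ProbabilityTheory.cond volume C)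
      (ProbabilityTheory.cond volume C) := by
  have hpre : Prod.swap ⁻¹' C = C := by
    ext ⟨x, y⟩
    exact ⟨fun h => hsymm y x h, fun h => hsymm x y h⟩
  have h : MeasurePreserving (Prod.swap : ℝ × ℝ → ℝ × ℝ) volume volume :=
    Measure.measurePreserving_swap
  have h' := h.restrict_preimage hC.measurableSet
  rw [hpre] at h'
  exact h'.smul_measure _

/-- Without bias, the laws on a symmetric set are symmetric. -/
lemma payoffCDF_law_zero_symm (hC : IsCompact C) (hint : (interior C).Nonempty)
    (hsymm : ∀ x y : ℝ, (x, y) ∈ C → (y, x) ∈ C) (n : ℕ) :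
    (∀ z, density C 0 n z.swap = density C 0 n z) ∧
      ∀ x, payoffCDF .one (law C 0 n) x = payoffCDF .two (law C 0 n) x := by
  have hdens {n : ℕ} (h : ∀ z, density C 0 n z.swap = density C 0 n z) (x : ℝ) :
      payoffCDF .one (law C 0 n) x = payoffCDF .two (law C 0 n) x := by
    rw [payoffCDF_law_eq_integral hC hint le_rfl (by norm_num),
      payoffCDF_law_eq_integral hC hint le_rfl (by norm_num),
      ← (measurePreserving_swap_cond hC hsymm).setIntegral_preimage_emb
        MeasurableEquiv.prodComm.measurableEmbedding]
    simp only [h]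
    rfl
  induction n with
  | zero => exact ⟨fun z => rfl, hdens fun z => rfl⟩
  | succ n ih =>
    have h (z : ℝ × ℝ) : density C 0 (n + 1) z.swap = density C 0 (n + 1) z := by
      simp only [density, stepDensity, ih.1, weight, mul_zero, Prod.fst_swap, Prod.snd_swap, ih.2]
      ring
    exact ⟨h, hdens h⟩

/-- Without bias on a symmetric set, there is a depth at which each player gets at most `x` with
probability less than `1 / 2`, provided that both players can get more than `x` simultaneously.
Otherwise the mass of the quadrant above `(x, x)` would not decrease; but that mass is at most the
mass below `(x, x)`, which vanishes in the limit. -/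
lemma exists_payoffCDF_lt_half (hC : IsCompact C) (hconv : Convex ℝ C)
    (hint : (interior C).Nonempty) (hsymm : ∀ x y : ℝ, (x, y) ∈ C → (y, x) ∈ C) {s x : ℝ}
    (hs : (s, s) ∈ C) (hx : x < s) : ∃ n, ∀ i : Player, payoffCDF i (law C 0 n) x < 1 / 2 := by
  have hsym (n : ℕ) := (payoffCDF_law_zero_symm hC hint hsymm n).2 x
  by_contra! hcon
  have hhalf (n : ℕ) : 1 / 2 ≤ payoffCDF .one (law C 0 n) x := by
    obtain ⟨i, hi⟩ := hcon n
    cases i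
    · exact hi
    · rwa [hsym]
  have hgrow := pow_mul_law_quadrant_le (ε := 0) hC hint le_rfl (by norm_num) (a := x) (b := x)
    (fun n => by simpa [threshold] using hhalf n)
    (fun n => by rw [← hsym]; simpa [threshold] using hhalf n)
  have hpos := law_zero_real_pos (ε := 0) hC hconv hint
    ((isOpen_Ioi (a := x)).prod (isOpen_Ioi (a := x))) ⟨(s, s), hs, hx, hx⟩
  have hlow : Tendsto (fun n => (law C 0 n).real (C ∩ Set.Iic (x, x))) atTop (𝓝 0) := by
    refine tendsto_law_of_isCompact hC hint le_rfl (by norm_num) (hC.inter_right isClosed_Iic)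
      fun w hw => ?_
    obtain ⟨t, ht, ht'⟩ := exists_mem_nhdsWithin_of_not_isParetoEfficient hC hconv hint
      (ε := 0) le_rfl (by norm_num) hw.1 fun hP => by
        have := hP.2 (s, s) hs ⟨hw.2.1.trans hx.le, hw.2.2.trans hx.le⟩
        have h1 : w.1 ≤ x := hw.2.1
        rw [← this] at h1
        exact absurd h1 (not_le.mpr hx)
    exact ⟨t, nhdsWithin_mono w Set.inter_subset_left ht, ht'⟩
  obtain ⟨n, hn⟩ := (hlow.eventually_lt_const hpos).exists
  refine absurd hn (not_lt.mpr ?_)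
  obtain ⟨hp, -, hnull⟩ := law_basic (ε := 0) hC hint le_rfl (by norm_num) n
  have hnull' : (law C 0 n).real Cᶜ = 0 := by simp [Measure.real, hnull]
  have h1 := hgrow n
  simp only [mul_zero, zero_mul, add_zero, one_pow, one_mul] at h1
  refine h1.trans ?_
  have hS (i : Player) : MeasurableSet {z : ℝ × ℝ | i.payoff z ≤ x} :=
    measurableSet_le (by fun_prop) (by fun_prop)
  have hcompl : Set.Ioi x ×ˢ Set.Ioi x =
      ({z : ℝ × ℝ | Player.one.payoff z ≤ x} ∪ {z | Player.two.payoff z ≤ x})ᶜ := by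
    ext z
    simp [Player.payoff]
  have hinter : (law C 0 n).real ({z : ℝ × ℝ | Player.one.payoff z ≤ x} ∩
      {z | Player.two.payoff z ≤ x}) ≤ (law C 0 n).real (C ∩ Set.Iic (x, x)) := by
    calc _ ≤ (law C 0 n).real ((C ∩ Set.Iic (x, x)) ∪ Cᶜ) := measureReal_mono fun z hz => by
          by_cases hzC : z ∈ C
          · exact Or.inl ⟨hzC, hz.1, hz.2⟩
          · exact Or.inr hzC
      _ ≤ _ := measureReal_union_le _ _
      _ = _ := by rw [hnull', add_zero]
  have hunion := measureReal_union_add_inter (μ := law C 0 n)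
    (s := {z : ℝ × ℝ | Player.one.payoff z ≤ x}) (hS .two)
  have h2 := hhalf n
  have h3 := hsym n
  unfold payoffCDF at h2 h3
  rw [hcompl, probReal_compl_eq_one_sub ((hS .one).union (hS .two))]
  linarith

/-- On a symmetric set, for small bias each player gets in the long run almost the maximal equal
share. -/
lemma eventually_exceeds (hC : IsCompact C) (hconv : Convex ℝ C)
    (hint : (interior C).Nonempty) (hsymm : ∀ x y : ℝ, (x, y) ∈ C → (y, x) ∈ C) {s x : ℝ}
    (hs : (s, s) ∈ C) (hx : x < s) : ∀ᶠ ε in 𝓝[>] (0 : ℝ), ∀ i : Player, Exceeds C ε i x := by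
  obtain ⟨n, hn⟩ := exists_payoffCDF_lt_half hC hconv hint hsymm hs hx
  have key (i : Player) : ∀ᶠ ε in 𝓝[>] (0 : ℝ), Exceeds C ε i x := by
    have hθ : Tendsto (fun ε => 1 / 2 + sign n i * threshold ε) (𝓝[>] 0) (𝓝 (1 / 2)) := by
      have hc : Continuous fun ε => 1 / 2 + sign n i * threshold ε := by
        unfold threshold
        refine continuous_const.add (continuous_const.mul (continuous_id.div (by fun_prop) ?_))
        intro ε
        positivity
      exact (hc.tendsto' 0 _ (by simp [threshold])).mono_left nhdsWithin_le_nhds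
    have hlt := ((tendsto_payoffCDF_law_bias hC hint n).2 i x).eventually_lt hθ (hn i)
    filter_upwards [hlt, Ioc_mem_nhdsGT (by norm_num : (0 : ℝ) < 1 / 2)] with ε h hε
    exact tendsto_payoffCDF_law hC hint hε.1 hε.2 h
  filter_upwards [key .one, key .two] with ε h h' i
  cases i <;> assumption

/-- A payoff that is exceeded in the long run is at most the limiting payoff. -/
lemma Exceeds.le {ε : ℝ} (hC : IsCompact C) (hint : (interior C).Nonempty) (h0 : 0 ≤ ε)
    (h1 : ε ≤ 1 / 2) {i : Player} {x : ℝ} (h : Exceeds C ε i x) {c : ℝ × ℝ}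
    (hc : ∀ U, IsOpen U → c ∈ U → Tendsto (fun n => (law C ε n).real Uᶜ) atTop (𝓝 0)) :
    x ≤ i.payoff c := by
  by_contra! hlt
  have h2 := hc {z | i.payoff z < x} (isOpen_lt i.continuous_payoff continuous_const) hlt
  have h3 := Tendsto.add h h2
  rw [add_zero] at h3
  refine absurd (ge_of_tendsto' h3 (b := 1) fun n => ?_) (by norm_num)
  have hp := (law_basic hC hint h0 h1 n).1
  calc (1 : ℝ) = (law C ε n).real Set.univ := probReal_univ.symm
    _ ≤ (law C ε n).real ({z | i.payoff z ≤ x} ∪ {z | i.payoff z < x}ᶜ) :=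
        measureReal_mono fun z _ => (lt_or_ge (i.payoff z) x).imp
          (fun h => le_of_lt h) (fun h => by simpa using h)
    _ ≤ _ := measureReal_union_le _ _

/-- The limiting points on a symmetric set approach the diagonal. -/
lemma tendsto_fst_sub_snd (hC : IsCompact C) (hconv : Convex ℝ C)
    (hint : (interior C).Nonempty) (hsymm : ∀ x y : ℝ, (x, y) ∈ C → (y, x) ∈ C)
    {c : ℝ → ℝ × ℝ} (hc : ∀ ε, 0 < ε → ε ≤ 1 / 2 → c ε ∈ C ∧ ∀ U, IsOpen U → c ε ∈ U →
      Tendsto (fun n => (law C ε n).real Uᶜ) atTop (𝓝 0)) :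
    Tendsto (fun ε => (c ε).1 - (c ε).2) (𝓝[>] 0) (𝓝 0) := by
  obtain ⟨d, hd, hmax⟩ := hC.exists_isMaxOn (hint.mono interior_subset)
    (f := fun z : ℝ × ℝ => z.1 + z.2) (by fun_prop)
  set s := (d.1 + d.2) / 2 with hs
  have hsC : (s, s) ∈ C := by
    have := hconv hd (hsymm d.1 d.2 hd) (a := 1 / 2) (b := 1 / 2) (by norm_num) (by norm_num)
      (by norm_num)
    convert this using 1
    ext <;> simp [hs] <;> ring
  rw [Metric.tendsto_nhds]
  intro δ hδ
  filter_upwards [eventually_exceeds hC hconv hint hsymm hsC (show s - δ / 4 < s by linarith),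
    Ioc_mem_nhdsGT (by norm_num : (0 : ℝ) < 1 / 2)] with ε h hε
  obtain ⟨hcC, hc'⟩ := hc ε hε.1 hε.2
  have h1 : s - δ / 4 ≤ (c ε).1 := (h .one).le hC hint hε.1.le hε.2 hc'
  have h2 : s - δ / 4 ≤ (c ε).2 := (h .two).le hC hint hε.1.le hε.2 hc'
  have h3 : (c ε).1 + (c ε).2 ≤ d.1 + d.2 := hmax hcC
  rw [Real.dist_eq, sub_zero, abs_lt]
  constructor <;> linarith

end Symmetric

end RandomGame

theorem mainTheorem1 (C : Set (ℝ × ℝ)) (hcomp : IsCompact C) (hconv : Convex ℝ C)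
    (hint : (interior C).Nonempty) :
    (∀ ε : ℝ, 0 < ε → ε ≤ 1 / 2 → ∀ n : ℕ,
      ∀ᵐ G ∂(RandomGame.hybridLaw C ε n),
        ∃! σ : RandomGame.Profile n, RandomGame.IsSubgamePerfect G σ) ∧
    ∃ c : ℝ → ℝ × ℝ,
      (∀ ε : ℝ, 0 < ε → ε ≤ 1 / 2 →
        RandomGame.IsParetoEfficient C (c ε) ∧
        RandomGame.ConcentratesAround (RandomGame.valueLaw C ε) (c ε)) ∧
      ((∀ x y : ℝ, (x, y) ∈ C → (y, x) ∈ C) →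
        Tendsto (fun ε => (c ε).1 - (c ε).2) (𝓝[>] 0) (𝓝 0)) := by
  refine ⟨fun ε h0 h1 n => ?_, ?_⟩
  · obtain ⟨-, -, h⟩ := RandomGame.map_inductionValue_hybridLaw hcomp hint h0.le h1 n
    exact h.mono fun G hG => hG.existsUnique_and_outcome.1
  have hex (ε : ℝ) : ∃ c, 0 < ε → ε ≤ 1 / 2 → RandomGame.IsParetoEfficient C c ∧
      ∀ U, IsOpen U → c ∈ U →
        Tendsto (fun n => (RandomGame.law C ε n).real Uᶜ) atTop (𝓝 0) := by
    by_cases h : 0 < ε ∧ ε ≤ 1 / 2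
    · obtain ⟨c, hc⟩ := RandomGame.exists_isParetoEfficient_forall_tendsto hcomp hconv hint h.1 h.2
      exact ⟨c, fun _ _ => hc⟩
    · exact ⟨0, fun h0 h1 => absurd ⟨h0, h1⟩ h⟩
  choose c hc using hex
  refine ⟨c, fun ε h0 h1 => ⟨(hc ε h0 h1).1, ?_⟩, fun hsymm => ?_⟩
  · rw [show RandomGame.valueLaw C ε = RandomGame.law C ε from
      funext (RandomGame.valueLaw_eq_law hcomp hint h0.le h1)]
    exact RandomGame.concentratesAround_of_forall_tendsto
      (fun n => (RandomGame.law_basic hcomp hint h0.le h1 n).1) (hc ε h0 h1).2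
  · exact RandomGame.tendsto_fst_sub_snd hcomp hconv hint hsymm
      fun ε h0 h1 => ⟨(hc ε h0 h1).1.1, (hc ε h0 h1).2⟩
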